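/- Let $n\ge 1$, $\beta>0$, $a>-1$, and let $V$ be a real polynomial with $V(t)\to+\infty$ as $t\to+\infty$. For $x\in(0,\infty)^n$ and $y\in(0,\infty)^{n-1}$ let $B=B(x,y)$ be the $n\times n$ lower bidiagonal matrix with $B_{i,i}=x_i$ $(1\le i\le n)$, $B_{i+1,i}=-y_i$ $(1\le i\le n-1)$ and all other entries zero. Then the function $$\exp\bigl[-n\beta\,\mathrm{tr}\,V(BB^T)\bigr]\prod_{k=1}^{n}x_k^{\beta(k+a)-1}\prod_{k=1}^{n-1}y_k^{\beta k-1}$$ has a finite positive integral over $(0,\infty)^{2n-1}$, and so has $$\prod_{1\le i<j\le n}|\lambda_i-\lambda_j|^{\beta}\prod_{i=1}^n\lambda_i^{\frac{\beta}{2}(a+1)-1}e^{-\beta nV(\lambda_i)}$$ over $(0,\infty)^n$. Let $f(\lambda)$ denote the second function divided by its integral. If the random vector $(X,Y)=(X_1,\dots,X_n,Y_1,\dots,Y_{n-1})$ has density on $(0,\infty)^{2n-1}$ proportional to the first function, then the eigenvalues of the random tridiagonal matrix $B(X,Y)B(X,Y)^T$ have joint density $f$, that is, they form the $\beta$-ensemble: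 listed in increasing order they have density $n!\,f$ on $\{0<\lambda_1<\dots<\lambda_n\}$, and listed in a uniformly random order (independent of $(X,Y)$) they have density $f$ on $(0,\infty)^n$. Moreover, for $V(t)=t/2$ the model is the Dumitriu–Edelman one: all the $X_k$ and $Y_k$ are independent, $X_k$ is distributed as $(n\beta)^{-1/2}\chi_{\beta(k+a)}$ and $Y_k$ as $(n\beta)^{-1/2}\chi_{\beta k}$, where $\chi_r$ $(r>0)$ has density proportional to $t^{r-1}e^{-t^2/2}$ on $(0,\infty)$. -/

import Mathlib

open MeasureTheory ProbabilityTheory Polynomial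
open scoped ENNReal Nat

noncomputable section

/-- The measure `μ` rescaled to total mass one (meaningful when `0 < μ univ < ∞`). -/
def normalizedMeasure {E : Type*} [MeasurableSpace E] (μ : Measure E) : Measure E :=
  (μ Set.univ)⁻¹ • μ

/-- The `n × n` lower bidiagonal matrix with diagonal entries `x_1, …, x_n` and subdiagonal
entries `-y_1, …, -y_{n-1}` (indices are shifted by one, as `Fin` starts at zero). -/
def bidiagonal {n : ℕ} (x : Fin n → ℝ) (y : Fin (n - 1) → ℝ) : Matrix (Fin n) (Fin n) ℝ :=
  fun i j =>
    if i = j then x i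
    else if h : (i : ℕ) = (j : ℕ) + 1 then - y ⟨j, by have := i.isLt; omega⟩
    else 0

/-- The tridiagonal matrix `B(x,y) B(x,y)ᵀ`. -/
def tridiagonal {n : ℕ} (x : Fin n → ℝ) (y : Fin (n - 1) → ℝ) : Matrix (Fin n) (Fin n) ℝ :=
  bidiagonal x y * (bidiagonal x y).transpose

theorem tridiagonal_isHermitian {n : ℕ} (x : Fin n → ℝ) (y : Fin (n - 1) → ℝ) :
    (tridiagonal x y).IsHermitian := by
  have h := Matrix.isHermitian_mul_conjTranspose_self (bidiagonal x y)
  rwa [Matrix.conjTranspose_eq_transpose_of_trivial] at h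

/-- The eigenvalues of `B(x,y) B(x,y)ᵀ`, repeated according to multiplicity and listed in
increasing order. -/
def orderedEigenvalues {n : ℕ} (x : Fin n → ℝ) (y : Fin (n - 1) → ℝ) : Fin n → ℝ :=
  fun i => (tridiagonal_isHermitian x y).eigenvalues₀ (Fin.cast (Fintype.card_fin n).symm i.rev)

/-- The unnormalized density
`exp(-n β tr V(B Bᵀ)) ∏_{k=1}^n x_k^{β(k+a)-1} ∏_{k=1}^{n-1} y_k^{βk-1}`. -/
def modelWeight (n : ℕ) (β a : ℝ) (V : ℝ[X]) (p : (Fin n → ℝ) × (Fin (n - 1) → ℝ)) : ℝ :=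
  Real.exp (-(n * β * (aeval (tridiagonal p.1 p.2) V).trace))
    * (∏ k : Fin n, p.1 k ^ (β * (((k : ℕ) + 1 : ℝ) + a) - 1))
    * ∏ k : Fin (n - 1), p.2 k ^ (β * ((k : ℕ) + 1 : ℝ) - 1)

/-- The law on `(0,∞)^n × (0,∞)^{n-1}` whose density is proportional to `modelWeight`. -/
def modelLaw (n : ℕ) (β a : ℝ) (V : ℝ[X]) : Measure ((Fin n → ℝ) × (Fin (n - 1) → ℝ)) :=
  normalizedMeasure ((volume.restrict {p | (∀ k, 0 < p.1 k) ∧ ∀ k, 0 < p.2 k}).withDensity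
    fun p => ENNReal.ofReal (modelWeight n β a V p))

/-- The unnormalized `β`-ensemble density
`∏_{i<j} |λ_i - λ_j|^β ∏_i λ_i^{β(a+1)/2-1} exp(-β n V(λ_i))`. -/
def ensembleWeight (n : ℕ) (β a : ℝ) (V : ℝ[X]) (l : Fin n → ℝ) : ℝ :=
  (∏ i : Fin n, ∏ j ∈ Finset.Ioi i, |l i - l j| ^ β)
    * ∏ i : Fin n, (l i ^ (β / 2 * (a + 1) - 1) * Real.exp (-(β * n * V.eval (l i))))

/-- The `β`-ensemble: the law of `n` (unordered, exchangeable) points on the positive half-line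
with joint density on `(0,∞)^n` proportional to `ensembleWeight`. -/
def betaEnsemble (n : ℕ) (β a : ℝ) (V : ℝ[X]) : Measure (Fin n → ℝ) :=
  normalizedMeasure ((volume.restrict {l | ∀ i, 0 < l i}).withDensity
    fun l => ENNReal.ofReal (ensembleWeight n β a V l))

/-- The law of a `χ_r` variable: density proportional to `t^{r-1} exp(-t²/2)` on `(0,∞)`. -/
def chiLaw (r : ℝ) : Measure ℝ :=
  normalizedMeasure ((volume.restrict (Set.Ioi 0)).withDensity
    fun t => ENNReal.ofReal (t ^ (r - 1) * Real.exp (-(t ^ 2 / 2))))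

end

/-! One set of moment sequences is parametrised in two ways, and the two Jacobians are compared.

A measure with masses w_i > 0 at n distinct points l_i > 0 is determined by its moments m_0, …,
m_{2n-1} (`eq_and_eq_of_pointMoment_eq`). Positive x, y and a number c > 0 yield such a measure:
B(x,-y)ᵀB(x,-y) has the spectrum of B(x,y)B(x,y)ᵀ, and its spectral measure at the last basis vector
is scaled to total mass c. It is convenient to unfold B into a tridiagonal matrix of size 2n with
zero diagonal (`pathMatrix`), whose weights z_1, z_2, … are the entries of B read from the bottom
up, with z_0 = c. Then m_k is z_0 (z_1⋯z_k)² plus a function of z_0, …, z_{k-1}. Hence positive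
weights can be recovered one at a time, and the Jacobian of z ↦ m is triangular
(`det_fderiv_pathMap_mul_prod`). The Jacobian of (w, l) ↦ m is a confluent Vandermonde determinant,
of modulus ∏w · Δ(l)⁴ (`abs_det_pointJacobian`). Both maps have the same image (`pathMap_image_eq`).

Hankel determinants of the moments, computed on both sides, give ∏w · Δ(l)² = cⁿ (∏ x_k^{k-1} ∏
y_k^k)² and ∏l = ∏x². Multiply the ensemble density by ∏ w_i^{β/2-1} e^{-w_i} and the model density
by c^{nβ/2-1} e^{-c}. As ∑w = c and tr V(BBᵀ) = ∑V(l_i), the enlarged densities correspond up to the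
Jacobians and the factor 2^{2n-1} (`weight_identity`). Integrating out w on one side and c on the
other leaves finite positive gamma factors, so the ordered eigenvalues carry the unnormalized model
to a constant multiple of the ensemble on increasing vectors (`exists_map_modelMeasure_eq`).

No normalizing constant has to be evaluated. Finiteness is checked for the ensemble alone and
transfers to the model. The unordered statement follows from the symmetry of the ensemble density
and the absence of ties. -/

/-- The symmetric tridiagonal matrix with zero diagonal whose entry in the places `(l - 1, l)` and
`(l, l - 1)` is `z l`, for `0 < l < N`. -/
def pathMatrix (N : ℕ) (z : ℕ → ℝ) : Matrix (Fin N) (Fin N) ℝ :=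
  fun i j => if (i : ℕ) + 1 = j then z j else if (j : ℕ) + 1 = i then z i else 0

/-! ### Moments of a path matrix and their triangular dependence on the weights. -/

section PathMatrix

variable {N : ℕ} {z z' : ℕ → ℝ}

theorem pathMatrix_isSymm (N : ℕ) (z : ℕ → ℝ) : (pathMatrix N z).IsSymm := by
  ext i j
  simp only [Matrix.transpose_apply, pathMatrix]
  split_ifs <;> first | rfl | omega

variable [NeZero N]

theorem pathMatrix_pow_succ_apply (k : ℕ) (i : Fin N) :
    (pathMatrix N z ^ (k + 1)) i 0 = ∑ j, pathMatrix N z i j * (pathMatrix N z ^ k) j 0 := by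
  rw [pow_succ', Matrix.mul_apply]

theorem pathMatrix_pow_apply_eq_zero_of_lt {k : ℕ} {i : Fin N} (h : k < i) :
    (pathMatrix N z ^ k) i 0 = 0 := by
  induction k generalizing i with
  | zero =>
    rw [pow_zero, Matrix.one_apply_ne]
    rintro rfl
    simp at h
  | succ k ih =>
    rw [pathMatrix_pow_succ_apply]
    refine Finset.sum_eq_zero fun j _ => ?_
    by_cases hj : k < (j : ℕ)
    · rw [ih hj, mul_zero]
    · rw [pathMatrix, if_neg (by omega), if_neg (by omega), zero_mul]

/-- The path is bipartite: each step changes the parity of the site. -/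
theorem pathMatrix_pow_apply_eq_zero_of_odd {k : ℕ} {i : Fin N} (h : Odd (k + (i : ℕ))) :
    (pathMatrix N z ^ k) i 0 = 0 := by
  induction k generalizing i with
  | zero =>
    rw [pow_zero, Matrix.one_apply_ne]
    rintro rfl
    simp at h
  | succ k ih =>
    rw [pathMatrix_pow_succ_apply]
    refine Finset.sum_eq_zero fun j _ => ?_
    by_cases hj : Odd (k + (j : ℕ))
    · rw [ih hj, mul_zero]
    · rw [Nat.odd_iff] at h hj
      rw [pathMatrix, if_neg (by omega), if_neg (by omega), zero_mul]

theorem pathMatrix_pow_apply_self {k : ℕ} (h : k < N) :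
    (pathMatrix N z ^ k) ⟨k, h⟩ 0 = ∏ l ∈ Finset.range k, z (l + 1) := by
  induction k with
  | zero => simp
  | succ k ih =>
    rw [pathMatrix_pow_succ_apply, Finset.sum_eq_single ⟨k, by omega⟩]
    · rw [ih, pathMatrix, if_neg (by simp; omega), if_pos (by simp), Finset.prod_range_succ, mul_comm]
    · intro j _ hj
      have hj' : (j : ℕ) ≠ k := fun h => hj (Fin.ext h)
      by_cases hk : k < (j : ℕ)
      · rw [pathMatrix_pow_apply_eq_zero_of_lt hk, mul_zero]
      · rw [pathMatrix, if_neg (by simp; omega), if_neg (by simp; omega), zero_mul]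
    · simp

/-- A walk of `k` steps from site `0` to site `i` that crosses edge `l` needs `l` steps to reach the
site `l` and then at least `l - i` to come back, so `2 * l ≤ k + i`. -/
theorem pathMatrix_pow_apply_congr {k : ℕ} {i : Fin N}
    (h : ∀ l, 1 ≤ l → 2 * l ≤ k + i → z l = z' l) :
    (pathMatrix N z ^ k) i 0 = (pathMatrix N z' ^ k) i 0 := by
  induction k generalizing i with
  | zero => simp
  | succ k ih =>
    rw [pathMatrix_pow_succ_apply, pathMatrix_pow_succ_apply]
    refine Finset.sum_congr rfl fun j _ => ?_
    by_cases hk : k < (j : ℕ)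
    · rw [pathMatrix_pow_apply_eq_zero_of_lt hk, pathMatrix_pow_apply_eq_zero_of_lt hk, mul_zero,
        mul_zero]
    · unfold pathMatrix
      split_ifs with h1 h2
      · rw [h _ (by omega) (by omega)]
        congr 1
        exact ih fun l hl hl' => h l hl (by omega)
      · rw [h _ (by omega) (by omega)]
        congr 1
        exact ih fun l hl hl' => h l hl (by omega)
      · simp

theorem pathMatrix_pow_add_apply (a b : ℕ) :
    (pathMatrix N z ^ (a + b)) 0 0 =
      ∑ i, (pathMatrix N z ^ a) i 0 * (pathMatrix N z ^ b) i 0 := by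
  rw [pow_add, Matrix.mul_apply]
  refine Finset.sum_congr rfl fun i _ => ?_
  rw [((pathMatrix_isSymm N z).pow a).apply i 0]

/-- The even moments, scaled by `z 0`, of the spectral measure of `pathMatrix N z` at the first
basis vector. -/
def pathMoment (N : ℕ) [NeZero N] (z : ℕ → ℝ) (k : ℕ) : ℝ :=
  z 0 * (pathMatrix N z ^ (2 * k)) 0 0

theorem pathMoment_eq_sum (k : ℕ) :
    pathMoment N z k = z 0 * ∑ i, (pathMatrix N z ^ k) i 0 ^ 2 := by
  rw [pathMoment, two_mul, pathMatrix_pow_add_apply]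
  simp only [sq]

/-- A moment differs from its leading term by a function of the earlier weights. -/
theorem pathMoment_sub_eq {k : ℕ} (hk : k < N) (h : ∀ l < k, z l = z' l) :
    pathMoment N z k - z 0 * (∏ l ∈ Finset.range k, z (l + 1)) ^ 2 =
      pathMoment N z' k - z' 0 * (∏ l ∈ Finset.range k, z' (l + 1)) ^ 2 := by
  rcases Nat.eq_zero_or_pos k with rfl | hk0
  · simp [pathMoment]
  · rw [pathMoment_eq_sum, pathMoment_eq_sum, ← pathMatrix_pow_apply_self hk,
      ← pathMatrix_pow_apply_self hk, ← Finset.add_sum_erase _ _ (Finset.mem_univ (⟨k, hk⟩ : Fin N)),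
      ← Finset.add_sum_erase _ _ (Finset.mem_univ (⟨k, hk⟩ : Fin N)), mul_add, mul_add,
      add_sub_cancel_left, add_sub_cancel_left, h 0 hk0]
    congr 1
    refine Finset.sum_congr rfl fun i hi => ?_
    have hi' : (i : ℕ) ≠ k := fun h => (Finset.mem_erase.1 hi).1 (Fin.ext h)
    by_cases hki : k < (i : ℕ)
    · rw [pathMatrix_pow_apply_eq_zero_of_lt hki, pathMatrix_pow_apply_eq_zero_of_lt hki]
    -- Here `i < k`, so a walk sees only edges with `2 * l ≤ k + i < 2 * k`.
    · rw [pathMatrix_pow_apply_congr fun l _ hl => h l (by omega)]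

theorem pathMoment_congr {k : ℕ} (hk : k < N) (h : ∀ l ≤ k, z l = z' l) :
    pathMoment N z k = pathMoment N z' k := by
  have h1 := pathMoment_sub_eq hk fun l hl => h l hl.le
  rw [h 0 (Nat.zero_le k), Finset.prod_congr rfl fun l hl =>
    h (l + 1) (Nat.succ_le_of_lt (Finset.mem_range.1 hl))] at h1
  exact sub_left_injective h1

theorem pathMoment_zero : pathMoment N z 0 = z 0 := by simp [pathMoment]

/-- Positive weights are determined by the moments. -/
theorem eq_of_pathMoment_eq (hz : ∀ l < N, 0 < z l) (hz' : ∀ l < N, 0 < z' l)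
    (h : ∀ k < N, pathMoment N z k = pathMoment N z' k) : ∀ k < N, z k = z' k := by
  intro k
  induction k using Nat.strong_induction_on with
  | _ k ih =>
    intro hk
    rcases k with _ | k
    · simpa [pathMoment_zero] using h 0 hk
    · have h1 := pathMoment_sub_eq hk fun l hl => ih l hl (hl.trans hk)
      rw [h _ hk, ih 0 (Nat.succ_pos k) (by omega), Finset.prod_range_succ, Finset.prod_range_succ,
        Finset.prod_congr rfl fun l hl => ih (l + 1)
          (by have := Finset.mem_range.1 hl; omega) (by have := Finset.mem_range.1 hl; omega)] at h1
      have hp : 0 < ∏ l ∈ Finset.range k, z' (l + 1) :=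
        Finset.prod_pos fun l hl => hz' _ (by have := Finset.mem_range.1 hl; omega)
      have h0 : 0 < z' 0 := hz' 0 (by omega)
      have h2 : z (k + 1) ^ 2 = z' (k + 1) ^ 2 := by
        have h3 : (z' 0 * (∏ l ∈ Finset.range k, z' (l + 1)) ^ 2) * z (k + 1) ^ 2 =
          (z' 0 * (∏ l ∈ Finset.range k, z' (l + 1)) ^ 2) * z' (k + 1) ^ 2 := by linarith
        exact mul_left_cancel₀ (by positivity) h3
      exact (sq_eq_sq₀ (hz _ hk).le (hz' _ hk).le).1 h2

/-- If a weight vanishes, some monic polynomial of that degree in the matrix annihilates the first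
basis vector. -/
theorem exists_monic_aeval_pathMatrix_eq_zero {k : ℕ} (hk : 0 < k) (hkN : k < N) (hz : z k = 0) :
    ∃ P : ℝ[X], P.Monic ∧ P.natDegree = k ∧ ∀ i, (aeval (pathMatrix N z) P) i 0 = 0 := by
  -- These are the monic orthogonal polynomials, P_{j+2} = X P_{j+1} - z_{j+1}² P_j. They satisfy
  -- P_j(A) e_0 = z_1⋯z_j e_j, which vanishes for j = k because of the factor z_k.
  have key : ∀ j, j ≤ k → ∃ P : ℝ[X], P.Monic ∧ P.natDegree = j ∧
      ∀ i : Fin N, (aeval (pathMatrix N z) P) i 0 =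
        if (i : ℕ) = j then ∏ l ∈ Finset.range j, z (l + 1) else 0 := by
    intro j
    induction j using Nat.strong_induction_on with
    | _ j ih =>
      intro hj
      rcases j with _ | _ | j
      · refine ⟨1, monic_one, natDegree_one, fun i => ?_⟩
        simp only [map_one, Matrix.one_apply, Fin.ext_iff]
        simp
      · refine ⟨Polynomial.X, monic_X, natDegree_X, fun i => ?_⟩
        simp only [aeval_X, pathMatrix]
        split_ifs <;> simp_all
      · obtain ⟨P, hP, hPd, hPv⟩ := ih (j + 1) (by omega) (by omega)
        obtain ⟨Q, hQ, hQd, hQv⟩ := ih j (by omega) (by omega)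
        have hlt : (C (z (j + 1) ^ 2) * Q).degree < (Polynomial.X * P).degree := by
          rw [degree_eq_natDegree (monic_X.mul hP).ne_zero, monic_X.natDegree_mul hP, natDegree_X]
          refine (degree_mul_le_of_le degree_C_le le_rfl).trans_lt ?_
          rw [degree_eq_natDegree hQ.ne_zero, zero_add, hPd, hQd]
          exact_mod_cast (by omega)
        refine ⟨Polynomial.X * P - C (z (j + 1) ^ 2) * Q, (monic_X.mul hP).sub_of_left hlt, ?_,
          fun i => ?_⟩
        · rw [natDegree_eq_of_degree_eq (degree_sub_eq_left_of_degree_lt hlt),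
            monic_X.natDegree_mul hP, natDegree_X, hPd, add_comm]
        · rw [map_sub, map_mul, map_mul, aeval_X, aeval_C, Matrix.sub_apply, Matrix.mul_apply,
            Algebra.algebraMap_eq_smul_one, smul_mul_assoc, one_mul, Matrix.smul_apply, hQv]
          rw [Finset.sum_eq_single ⟨j + 1, by omega⟩, hPv, if_pos rfl]
          · simp only [pathMatrix, smul_eq_mul]
            split_ifs <;> try omega
            · rw [Finset.prod_range_succ]; ring
            · rw [Finset.prod_range_succ _ (j + 1), mul_zero, sub_zero, mul_comm]
              congr 2
            · ring
          · intro l _ hl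
            rw [hPv, if_neg, mul_zero]
            exact fun h => hl (Fin.ext h)
          · simp
  obtain ⟨P, hP, hPd, hPv⟩ := key k le_rfl
  refine ⟨P, hP, hPd, fun i => ?_⟩
  rw [hPv, ite_eq_right_iff]
  intro _
  refine Finset.prod_eq_zero (i := k - 1) (Finset.mem_range.2 (by omega)) ?_
  rw [Nat.sub_add_cancel hk, hz]

end PathMatrix

/-! ### Moments of point measures; Hankel determinants of both kinds of moments. -/

/-- The moments of the measure with mass `w i` at the point `l i`. -/
def pointMoment {n : ℕ} (l w : Fin n → ℝ) (k : ℕ) : ℝ := ∑ i, w i * l i ^ k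

section PointMoment

variable {n : ℕ}

theorem sum_mul_eval_eq_of_pointMoment_eq {l w l' w' : Fin n → ℝ} {m : ℕ}
    (h : ∀ k < m, pointMoment l w k = pointMoment l' w' k) {p : ℝ[X]} (hp : p.natDegree < m) :
    ∑ i, w i * p.eval (l i) = ∑ i, w' i * p.eval (l' i) := by
  have key : ∀ l w : Fin n → ℝ, ∑ i, w i * p.eval (l i) =
      ∑ k ∈ Finset.range m, p.coeff k * pointMoment l w k := by
    intro l w
    simp only [pointMoment, Finset.mul_sum, eval_eq_sum_range' hp]
    rw [Finset.sum_comm]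
    exact Finset.sum_congr rfl fun _ _ => Finset.sum_congr rfl fun _ _ => by ring
  rw [key, key]
  exact Finset.sum_congr rfl fun k hk => by rw [h k (Finset.mem_range.1 hk)]

theorem natDegree_prod_X_sub_C_le (s : Finset (Fin n)) (l : Fin n → ℝ) :
    (∏ j ∈ s, (Polynomial.X - C (l j))).natDegree = s.card := by
  rw [natDegree_prod_of_monic _ _ fun j _ => monic_X_sub_C _]
  simp

/-- Test both measures against the polynomial of degree `2 n - 1` that vanishes at every `l' j` and
at every `l j` with `j ≠ i`. The second sum is zero, and only the term at `l i` survives in the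
first, so `l i` is one of the `l' j`. -/
theorem range_subset_of_pointMoment_eq {l w l' w' : Fin n → ℝ} (hl : Function.Injective l)
    (hw : ∀ i, w i ≠ 0) (h : ∀ k < n * 2, pointMoment l w k = pointMoment l' w' k) :
    Set.range l ⊆ Set.range l' := by
  rintro _ ⟨i, rfl⟩
  have hdeg : ((∏ j, (Polynomial.X - C (l' j))) *
      ∏ j ∈ Finset.univ.erase i, (Polynomial.X - C (l j))).natDegree < n * 2 := by
    refine natDegree_mul_le.trans_lt ?_
    rw [natDegree_prod_X_sub_C_le, natDegree_prod_X_sub_C_le,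
      Finset.card_erase_of_mem (Finset.mem_univ i), Finset.card_univ, Fintype.card_fin]
    have := i.isLt
    omega
  have h1 := sum_mul_eval_eq_of_pointMoment_eq h hdeg
  simp only [eval_mul, eval_prod, eval_sub, eval_X, eval_C] at h1
  rw [Finset.sum_eq_single i, Finset.sum_eq_zero] at h1
  · rw [mul_eq_zero, mul_eq_zero, Finset.prod_eq_zero_iff, Finset.prod_eq_zero_iff] at h1
    rcases h1 with h1 | ⟨j, _, hj⟩ | ⟨j, hj, hj'⟩
    · exact absurd h1 (hw i)
    · exact ⟨j, (sub_eq_zero.1 hj).symm⟩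
    · exact absurd (hl (sub_eq_zero.1 hj')).symm (Finset.ne_of_mem_erase hj)
  · intro j _
    rw [Finset.prod_eq_zero (Finset.mem_univ j) (sub_self _), zero_mul, mul_zero]
  · intro j _ hj
    rw [Finset.prod_eq_zero (Finset.mem_erase.2 ⟨hj, Finset.mem_univ j⟩) (sub_self _), mul_zero,
      mul_zero]
  · simp

/-- An `n`-point measure is determined by its first `2 n` moments. -/
theorem eq_and_eq_of_pointMoment_eq {l w l' w' : Fin n → ℝ} (hl : StrictMono l)
    (hl' : StrictMono l') (hw : ∀ i, w i ≠ 0) (hw' : ∀ i, w' i ≠ 0)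
    (h : ∀ k < n * 2, pointMoment l w k = pointMoment l' w' k) : l = l' ∧ w = w' := by
  have hll : l = l' := (hl.range_inj hl').1 <|
    (range_subset_of_pointMoment_eq hl.injective hw h).antisymm
      (range_subset_of_pointMoment_eq hl'.injective hw' fun k hk => (h k hk).symm)
  subst hll
  refine ⟨rfl, funext fun i => ?_⟩
  -- Once the points agree, a polynomial vanishing at all of them except `l i` isolates the mass `w
  -- i`.
  have hdeg : (∏ j ∈ Finset.univ.erase i, (Polynomial.X - C (l j))).natDegree < n * 2 := by
    rw [natDegree_prod_X_sub_C_le, Finset.card_erase_of_mem (Finset.mem_univ i),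
      Finset.card_univ, Fintype.card_fin]
    have := i.isLt
    omega
  have h1 := sum_mul_eval_eq_of_pointMoment_eq h hdeg
  simp only [eval_prod, eval_sub, eval_X, eval_C] at h1
  have h0 : ∀ w : Fin n → ℝ, ∀ j ∈ Finset.univ, j ≠ i →
      w j * ∏ m ∈ Finset.univ.erase i, (l j - l m) = 0 := fun w j _ hj => by
    rw [Finset.prod_eq_zero (Finset.mem_erase.2 ⟨hj, Finset.mem_univ j⟩) (sub_self _), mul_zero]
  rw [Finset.sum_eq_single i (h0 w) (by simp), Finset.sum_eq_single i (h0 w') (by simp)] at h1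
  refine mul_right_cancel₀ (Finset.prod_ne_zero_iff.2 fun j hj => ?_) h1
  exact sub_ne_zero.2 fun h => Finset.ne_of_mem_erase hj (hl.injective h).symm

/-- The Hankel matrix factors as Vᵀ diag(w) V with V the Vandermonde matrix. -/
theorem det_hankel_pointMoment (l w : Fin n → ℝ) :
    (Matrix.of fun a b : Fin n => pointMoment l w (a + b)).det =
      (∏ i, w i) * (Matrix.vandermonde l).det ^ 2 := by
  have : (Matrix.of fun a b : Fin n => pointMoment l w (a + b)) =
      (Matrix.vandermonde l).transpose * (Matrix.diagonal w * Matrix.vandermonde l) := by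
    ext a b
    rw [Matrix.mul_apply, Matrix.of_apply, pointMoment]
    refine Finset.sum_congr rfl fun i _ => ?_
    rw [Matrix.diagonal_mul, Matrix.transpose_apply, Matrix.vandermonde_apply,
      Matrix.vandermonde_apply]
    ring
  rw [this, Matrix.det_mul, Matrix.det_mul, Matrix.det_transpose, Matrix.det_diagonal]
  ring

theorem det_hankel_succ_pointMoment (l w : Fin n → ℝ) :
    (Matrix.of fun a b : Fin n => pointMoment l w (a + b + 1)).det =
      (∏ i, w i) * (∏ i, l i) * (Matrix.vandermonde l).det ^ 2 := by
  rw [← Finset.prod_mul_distrib, ← det_hankel_pointMoment]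
  congr 2
  ext a b
  exact Finset.sum_congr rfl fun i _ => by ring

theorem sum_fin_mul_two (f : Fin (n * 2) → ℝ) :
    ∑ i, f i = ∑ a : Fin n, (f ⟨2 * a, by omega⟩ + f ⟨2 * a + 1, by omega⟩) := by
  rw [← finProdFinEquiv.sum_comp, Fintype.sum_prod_type]
  refine Finset.sum_congr rfl fun a _ => ?_
  rw [Fin.sum_univ_two]
  congr 2 <;> ext <;> simp [finProdFinEquiv, add_comm]

variable [NeZero n]

/-- Up to the factor `z 0`, the Hankel matrix is the Gram matrix of the vectors A^{2a} e_0. These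
live on the even sites, and in that basis they form a triangular matrix. -/
theorem det_hankel_pathMoment (z : ℕ → ℝ) :
    (Matrix.of fun a b : Fin n => pathMoment (n * 2) z (a + b)).det =
      z 0 ^ n * ∏ a : Fin n, (∏ l ∈ Finset.range (2 * a), z (l + 1)) ^ 2 := by
  set R : Matrix (Fin n) (Fin n) ℝ := Matrix.of fun s a =>
    (pathMatrix (n * 2) z ^ (2 * (a : ℕ))) ⟨2 * s, by omega⟩ 0
  have : (Matrix.of fun a b : Fin n => pathMoment (n * 2) z (a + b)) =
      z 0 • (R.transpose * R) := by
    ext a b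
    rw [Matrix.smul_apply, Matrix.mul_apply, Matrix.of_apply, pathMoment, mul_add,
      pathMatrix_pow_add_apply, sum_fin_mul_two, smul_eq_mul]
    congr 1
    refine Finset.sum_congr rfl fun s _ => ?_
    rw [Matrix.transpose_apply]
    simp only [R, Matrix.of_apply]
    rw [add_eq_left, pathMatrix_pow_apply_eq_zero_of_odd, zero_mul]
    exact ⟨a + s, by simp; ring⟩
  have hR : R.det = ∏ a : Fin n, ∏ l ∈ Finset.range (2 * a), z (l + 1) := by
    rw [Matrix.det_of_isUpperTriangular]
    · exact Finset.prod_congr rfl fun a _ => pathMatrix_pow_apply_self _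
    · intro i j hij
      exact pathMatrix_pow_apply_eq_zero_of_lt (by simp at hij ⊢; omega)
  rw [this, Matrix.det_smul, Matrix.det_mul, Matrix.det_transpose, hR, Fintype.card_fin,
    Finset.prod_pow]
  ring

/-- As before, with the vectors A^{2a+1} e_0, which live on the odd sites. -/
theorem det_hankel_succ_pathMoment (z : ℕ → ℝ) :
    (Matrix.of fun a b : Fin n => pathMoment (n * 2) z (a + b + 1)).det =
      z 0 ^ n * ∏ a : Fin n, (∏ l ∈ Finset.range (2 * a + 1), z (l + 1)) ^ 2 := by
  set R : Matrix (Fin n) (Fin n) ℝ := Matrix.of fun s a =>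
    (pathMatrix (n * 2) z ^ (2 * (a : ℕ) + 1)) ⟨2 * s + 1, by omega⟩ 0
  have : (Matrix.of fun a b : Fin n => pathMoment (n * 2) z (a + b + 1)) =
      z 0 • (R.transpose * R) := by
    ext a b
    have hab : 2 * ((a : ℕ) + b + 1) = (2 * a + 1) + (2 * b + 1) := by ring
    rw [Matrix.smul_apply, Matrix.mul_apply, Matrix.of_apply, pathMoment, hab,
      pathMatrix_pow_add_apply, sum_fin_mul_two, smul_eq_mul]
    congr 1
    refine Finset.sum_congr rfl fun s _ => ?_
    rw [Matrix.transpose_apply]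
    simp only [R, Matrix.of_apply]
    rw [add_eq_right, pathMatrix_pow_apply_eq_zero_of_odd, zero_mul]
    exact ⟨a + s, by simp; ring⟩
  have hR : R.det = ∏ a : Fin n, ∏ l ∈ Finset.range (2 * a + 1), z (l + 1) := by
    rw [Matrix.det_of_isUpperTriangular]
    · exact Finset.prod_congr rfl fun a _ => pathMatrix_pow_apply_self _
    · intro i j hij
      exact pathMatrix_pow_apply_eq_zero_of_lt (by simp at hij ⊢; omega)
  rw [this, Matrix.det_smul, Matrix.det_mul, Matrix.det_transpose, hR, Fintype.card_fin,
    Finset.prod_pow]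
  ring

end PointMoment

/-! ### Every positive point measure is reached by positive path weights. -/

section Existence

variable {n : ℕ} [NeZero n]

/-- If the moments of two families agree below `k` and the `k`-th weight vanishes, then the `k`-th
moment of the point measure is larger. -/
theorem pathMoment_lt_pointMoment {l w : Fin n → ℝ} (hl : Function.Injective l)
    (hl0 : ∀ i, 0 < l i) (hw : ∀ i, 0 < w i) {z : ℕ → ℝ} {k : ℕ} (hk : 0 < k) (hkn : k < n * 2)
    (hz : z k = 0) (h : ∀ j < k, pathMoment (n * 2) z j = pointMoment l w j) :
    pathMoment (n * 2) z k < pointMoment l w k := by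
  obtain ⟨P, hP, hPd, hPv⟩ := exists_monic_aeval_pathMatrix_eq_zero hk hkn hz
  have hQd : (P * P).natDegree = 2 * k := by rw [hP.natDegree_mul hP, hPd, two_mul]
  -- The point measure is pulled back to the symmetric measure with mass `w i / 2` at each of `±√(l
  -- i)`, whose odd moments vanish like those of the path.
  have hdiff : ∀ j, (∑ i, w i / 2 * (√(l i) ^ j + (-√(l i)) ^ j)) -
      z 0 * (pathMatrix (n * 2) z ^ j) 0 0 =
      if Even j then pointMoment l w (j / 2) - pathMoment (n * 2) z (j / 2) else 0 := by
    intro j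
    split_ifs with hj
    · obtain ⟨m, rfl⟩ := even_iff_exists_two_mul.1 hj
      rw [Nat.mul_div_cancel_left _ two_pos, pathMoment, pointMoment]
      congr 1
      refine Finset.sum_congr rfl fun i _ => ?_
      rw [pow_mul, pow_mul, neg_sq, Real.sq_sqrt (hl0 i).le]
      ring
    · rw [Nat.not_even_iff_odd] at hj
      rw [pathMatrix_pow_apply_eq_zero_of_odd (by simpa using hj), Finset.sum_eq_zero]
      · simp
      · intro i _
        rw [hj.neg_pow]
        ring
  -- `P * P` is monic of degree `2 * k` and all lower moments agree, so the two integrals of `P * P`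
  -- differ exactly by the difference of the top moments. The path integral is zero, and the other
  -- is a weighted sum of squares.
  have h1 : (∑ i, w i / 2 * ((P * P).eval √(l i) + (P * P).eval (-√(l i)))) -
      z 0 * (aeval (pathMatrix (n * 2) z) (P * P)) 0 0 =
      pointMoment l w k - pathMoment (n * 2) z k := by
    have h2 : (∑ i, w i / 2 * ((P * P).eval √(l i) + (P * P).eval (-√(l i)))) -
        z 0 * (aeval (pathMatrix (n * 2) z) (P * P)) 0 0 =
        ∑ j ∈ Finset.range (2 * k + 1), (P * P).coeff j *
          ((∑ i, w i / 2 * (√(l i) ^ j + (-√(l i)) ^ j)) -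
            z 0 * (pathMatrix (n * 2) z ^ j) 0 0) := by
      have hlt : (P * P).natDegree < 2 * k + 1 := by omega
      simp only [eval_eq_sum_range' hlt, aeval_eq_sum_range' hlt, mul_sub, Finset.sum_sub_distrib,
        Matrix.sum_apply, Matrix.smul_apply, smul_eq_mul, Finset.mul_sum, ← Finset.sum_add_distrib]
      congr 1
      · rw [Finset.sum_comm]
        exact Finset.sum_congr rfl fun _ _ => Finset.sum_congr rfl fun _ _ => by ring
      · exact Finset.sum_congr rfl fun _ _ => by ring
    rw [h2, Finset.sum_range_succ, Finset.sum_eq_zero, hdiff, if_pos (even_two_mul k),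
      Nat.mul_div_cancel_left _ two_pos, ← hQd, (hP.mul hP).coeff_natDegree, zero_add, one_mul]
    intro j hj
    rw [Finset.mem_range] at hj
    rw [hdiff, h _ (by omega)]
    simp
  have h3 : (aeval (pathMatrix (n * 2) z) (P * P)) 0 0 = 0 := by
    rw [map_mul, Matrix.mul_apply]
    exact Finset.sum_eq_zero fun i _ => by rw [hPv, mul_zero]
  rw [← sub_pos, ← h1, h3, mul_zero, sub_zero]
  have hterm : ∀ i, 0 ≤ w i / 2 * ((P * P).eval √(l i) + (P * P).eval (-√(l i))) := fun i => by
    have := hw i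
    rw [eval_mul, eval_mul]
    positivity [mul_self_nonneg (P.eval √(l i)), mul_self_nonneg (P.eval (-√(l i)))]
  refine lt_of_le_of_ne (Finset.sum_nonneg fun i _ => hterm i) fun h0 => hP.ne_zero ?_
  have h4 : ∀ i, P.eval √(l i) = 0 ∧ P.eval (-√(l i)) = 0 := fun i => by
    have h5 := (Finset.sum_eq_zero_iff_of_nonneg fun i _ => hterm i).1 h0.symm i (Finset.mem_univ i)
    have h6 := hw i
    rw [eval_mul, eval_mul, mul_eq_zero, or_iff_right (by positivity)] at h5
    exact mul_self_add_mul_self_eq_zero.1 h5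
  -- Equality would give `P`, of degree `k < 2 n`, the `2 n` distinct zeros `±√(l i)`.
  refine eq_zero_of_natDegree_lt_card_of_eval_eq_zero P
    (f := (Sum.elim (fun i => √(l i)) fun i => -√(l i) : Fin n ⊕ Fin n → ℝ)) ?_ ?_ ?_
  · refine Function.Injective.sumElim ?_ ?_ ?_
    · exact fun i j hij => hl ((Real.sqrt_inj (hl0 i).le (hl0 j).le).1 hij)
    · exact fun i j hij => hl ((Real.sqrt_inj (hl0 i).le (hl0 j).le).1 (neg_injective hij))
    · intro i j hij
      have := Real.sqrt_pos.2 (hl0 i)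
      have := Real.sqrt_pos.2 (hl0 j)
      linarith
  · rintro (i | i)
    · exact (h4 i).1
    · exact (h4 i).2
  · simp only [Fintype.card_sum, Fintype.card_fin]
    omega

/-- Every `n`-point measure on the positive half-line has the moments of a path matrix. -/
theorem exists_pathMoment_eq_pointMoment {l w : Fin n → ℝ} (hl : Function.Injective l)
    (hl0 : ∀ i, 0 < l i) (hw : ∀ i, 0 < w i) :
    ∃ z : ℕ → ℝ, (∀ k < n * 2, 0 < z k) ∧
      ∀ k < n * 2, pathMoment (n * 2) z k = pointMoment l w k := by
  have key : ∀ m ≤ n * 2, ∃ z : ℕ → ℝ, (∀ k < m, 0 < z k) ∧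
      ∀ k < m, pathMoment (n * 2) z k = pointMoment l w k := by
    intro m
    induction m with
    | zero => exact fun _ => ⟨0, by simp, by simp⟩
    | succ k ih =>
      intro hk
      obtain ⟨z, hz, hzm⟩ := ih (by omega)
      have hup : ∀ x, ∀ j < k, Function.update z k x j = z j := fun x j hj =>
        Function.update_of_ne hj.ne x z
      suffices ∃ x, 0 < x ∧ pathMoment (n * 2) (Function.update z k x) k = pointMoment l w k by
        obtain ⟨x, hx, hxk⟩ := this
        refine ⟨Function.update z k x, fun j hj => ?_, fun j hj => ?_⟩
        · rcases Nat.lt_succ_iff_lt_or_eq.1 hj with hj | rfl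
          · rw [hup x j hj]; exact hz j hj
          · simpa using hx
        · rcases Nat.lt_succ_iff_lt_or_eq.1 hj with hj | rfl
          · rw [← hzm j hj]
            exact pathMoment_congr (by omega) fun i hi => hup x i (by omega)
          · exact hxk
      rcases Nat.eq_zero_or_pos k with rfl | hk0
      · refine ⟨pointMoment l w 0, ?_, by simp [pathMoment_zero]⟩
        simp only [pointMoment, pow_zero, mul_one]
        exact Finset.sum_pos (fun i _ => hw i) Finset.univ_nonempty
      · obtain ⟨k, rfl⟩ := Nat.exists_eq_succ_of_ne_zero hk0.ne'
        have hlt := pathMoment_lt_pointMoment hl hl0 hw hk0 hk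
          (Function.update_self (k + 1) 0 z) fun j hj => by
            rw [← hzm j hj]
            exact pathMoment_congr (by omega) fun i hi => hup 0 i (by omega)
        set r := pathMoment (n * 2) (Function.update z (k + 1) 0) (k + 1)
        set A := z 0 * (∏ j ∈ Finset.range k, z (j + 1)) ^ 2
        have hA : 0 < A := mul_pos (hz 0 hk0) <| pow_pos (Finset.prod_pos fun j hj =>
          hz _ (by have := Finset.mem_range.1 hj; omega)) 2
        -- The moment of order `k + 1` is `A * x ^ 2 + r` as a function of the new weight `x`, where
        -- `r` is its value at `x = 0`. The strict inequality `hlt` makes the square root positive.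
        refine ⟨√((pointMoment l w (k + 1) - r) / A),
          Real.sqrt_pos.2 (div_pos (sub_pos.2 hlt) hA), ?_⟩
        set x := √((pointMoment l w (k + 1) - r) / A)
        have hx : A * x ^ 2 = pointMoment l w (k + 1) - r := by
          rw [Real.sq_sqrt (div_pos (sub_pos.2 hlt) hA).le, mul_div_cancel₀ _ hA.ne']
        have hsub := pathMoment_sub_eq (z := Function.update z (k + 1) x)
          (z' := Function.update z (k + 1) 0) hk fun j hj => by rw [hup x j hj, hup 0 j hj]
        have hpr : ∀ y, ∏ j ∈ Finset.range k, Function.update z (k + 1) y (j + 1) =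
            ∏ j ∈ Finset.range k, z (j + 1) := fun y => Finset.prod_congr rfl fun j hj =>
          hup y _ (by have := Finset.mem_range.1 hj; omega)
        rw [Finset.prod_range_succ, Finset.prod_range_succ, hpr, hpr, hup _ 0 hk0, hup _ 0 hk0,
          Function.update_self, Function.update_self] at hsub
        change _ = r - _ at hsub
        have : A = z 0 * (∏ j ∈ Finset.range k, z (j + 1)) ^ 2 := rfl
        linear_combination hsub + hx - x ^ 2 * this
  exact key _ le_rfl

end Existence

/-! ### Bidiagonal matrices unfolded into path matrices. -/

/-- The extension by zero of a finite sequence. -/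
def zeroExtend {N : ℕ} (u : Fin N → ℝ) (l : ℕ) : ℝ := if h : l < N then u ⟨l, h⟩ else 0

theorem zeroExtend_of_lt {N : ℕ} (u : Fin N → ℝ) {l : ℕ} (h : l < N) :
    zeroExtend u l = u ⟨l, h⟩ := dif_pos h

theorem zeroExtend_val {N : ℕ} (u : Fin N → ℝ) (l : Fin N) : zeroExtend u l = u l :=
  zeroExtend_of_lt u l.isLt

section Weights

variable {n : ℕ} [NeZero n]

/-- The order of the sites of the path: a mass parameter first, then the entries of a bidiagonal
matrix, alternating between diagonal and subdiagonal, from the bottom to the top. -/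
def siteFun (n : ℕ) [NeZero n] : (Fin n ⊕ Fin (n - 1)) ⊕ Unit → Fin (n * 2)
  | .inl (.inl i) => ⟨2 * (n - 1 - i) + 1, by omega⟩
  | .inl (.inr i) => ⟨2 * (n - 1 - i), by omega⟩
  | .inr () => 0

theorem siteFun_bijective (n : ℕ) [NeZero n] : Function.Bijective (siteFun n) := by
  have hn : 0 < n := NeZero.pos n
  rw [Fintype.bijective_iff_injective_and_card]
  constructor
  · rintro ((i | i) | i) ((j | j) | j) h <;>
      simp only [siteFun, Fin.ext_iff, Fin.val_zero, Sum.inl.injEq, Sum.inr.injEq, reduceCtorEq]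
        at h ⊢ <;> omega
  · simp only [Fintype.card_sum, Fintype.card_fin, Fintype.card_unit]
    omega

/-- `siteFun` as an equivalence. -/
noncomputable def siteEquiv (n : ℕ) [NeZero n] : (Fin n ⊕ Fin (n - 1)) ⊕ Unit ≃ Fin (n * 2) :=
  Equiv.ofBijective _ (siteFun_bijective n)

/-- The weights on the path belonging to a bidiagonal matrix and a mass. -/
noncomputable def pathWeights (x : Fin n → ℝ) (y : Fin (n - 1) → ℝ) (c : ℝ) : Fin (n * 2) → ℝ :=
  fun l => Sum.elim (Sum.elim x y) (fun _ => c) ((siteEquiv n).symm l)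

variable {x : Fin n → ℝ} {y : Fin (n - 1) → ℝ} {c : ℝ}

theorem pathWeights_siteFun (s : (Fin n ⊕ Fin (n - 1)) ⊕ Unit) :
    pathWeights x y c (siteFun n s) = Sum.elim (Sum.elim x y) (fun _ => c) s :=
  congrArg _ ((siteEquiv n).symm_apply_apply s)

theorem pathWeights_pos_iff :
    (∀ l, 0 < pathWeights x y c l) ↔ ((∀ i, 0 < x i) ∧ ∀ i, 0 < y i) ∧ 0 < c := by
  rw [← (siteEquiv n).forall_congr_right]
  simp [pathWeights, Sum.forall]

theorem zeroExtend_pathWeights_zero : zeroExtend (pathWeights x y c) 0 = c := by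
  rw [zeroExtend_of_lt _ (by have := NeZero.pos n; omega)]
  exact pathWeights_siteFun (.inr ())

theorem zeroExtend_pathWeights_odd (i : Fin n) :
    zeroExtend (pathWeights x y c) (2 * (n - 1 - i) + 1) = x i := by
  rw [zeroExtend_of_lt _ (by omega)]
  exact pathWeights_siteFun (.inl (.inl i))

theorem zeroExtend_pathWeights_even (i : Fin (n - 1)) :
    zeroExtend (pathWeights x y c) (2 * (n - 1 - i)) = y i := by
  rw [zeroExtend_of_lt _ (by omega)]
  exact pathWeights_siteFun (.inl (.inr i))

/-- The splitting of the path into its even and odd sites, both in reverse order. -/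
def bipartitionFun (n : ℕ) : Fin n ⊕ Fin n → Fin (n * 2)
  | .inl i => ⟨2 * (n - 1 - i), by omega⟩
  | .inr i => ⟨2 * (n - 1 - i) + 1, by omega⟩

theorem bipartitionFun_bijective (n : ℕ) : Function.Bijective (bipartitionFun n) := by
  rw [Fintype.bijective_iff_injective_and_card]
  constructor
  · rintro (i | i) (j | j) h <;>
      simp only [bipartitionFun, Fin.ext_iff, Sum.inl.injEq, Sum.inr.injEq, reduceCtorEq]
        at h ⊢ <;> omega
  · simp only [Fintype.card_sum, Fintype.card_fin]
    omega

/-- `bipartitionFun` as an equivalence. -/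
noncomputable def bipartitionEquiv (n : ℕ) : Fin n ⊕ Fin n ≃ Fin (n * 2) :=
  Equiv.ofBijective _ (bipartitionFun_bijective n)

/-- Edges join even sites to odd ones, so both diagonal blocks vanish. All weights enter the path
with a plus sign, which is why `y` is negated to cancel the sign in `bidiagonal`. -/
theorem pathMatrix_submatrix_bipartition :
    (pathMatrix (n * 2) (zeroExtend (pathWeights x y c))).submatrix (bipartitionEquiv n)
      (bipartitionEquiv n) =
    Matrix.fromBlocks 0 (bidiagonal x (-y)).transpose (bidiagonal x (-y)) 0 := by
  have key : ∀ i j : Fin n, pathMatrix (n * 2) (zeroExtend (pathWeights x y c))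
      (bipartitionFun n (.inr i)) (bipartitionFun n (.inl j)) = bidiagonal x (-y) i j := by
    intro i j
    unfold pathMatrix bidiagonal bipartitionFun
    simp only [Fin.ext_iff]
    split_ifs with h1 h2 h3 h4 h5 h6 h7
    · omega
    · rw [Pi.neg_apply, neg_neg]
      exact zeroExtend_pathWeights_even (n := n) ⟨j, by omega⟩
    · omega
    · exact zeroExtend_pathWeights_odd i
    all_goals first | omega | rfl
  ext (i | i) (j | j)
  · rw [Matrix.submatrix_apply, Matrix.fromBlocks_apply₁₁, Matrix.zero_apply]
    change pathMatrix _ _ (bipartitionFun n (.inl i)) (bipartitionFun n (.inl j)) = 0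
    unfold pathMatrix bipartitionFun
    simp only
    rw [if_neg (by omega), if_neg (by omega)]
  · rw [Matrix.submatrix_apply, Matrix.fromBlocks_apply₁₂, Matrix.transpose_apply, ← key,
      ← (pathMatrix_isSymm _ _).apply]
    rfl
  · rw [Matrix.submatrix_apply, Matrix.fromBlocks_apply₂₁, ← key]
    rfl
  · rw [Matrix.submatrix_apply, Matrix.fromBlocks_apply₂₂, Matrix.zero_apply]
    change pathMatrix _ _ (bipartitionFun n (.inr i)) (bipartitionFun n (.inr j)) = 0
    unfold pathMatrix bipartitionFun
    simp only
    rw [if_neg (by omega), if_neg (by omega)]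

/-- The square of the block matrix is block diagonal, with BᵀB for B = B(x,-y) on the even sites.
Reversing the order puts site `0` at the last index `n - 1`. -/
theorem pathMoment_pathWeights (k : ℕ) :
    pathMoment (n * 2) (zeroExtend (pathWeights x y c)) k =
      c * (((bidiagonal x (-y)).transpose * bidiagonal x (-y)) ^ k)
        ⟨n - 1, Nat.sub_lt (NeZero.pos n) one_pos⟩ ⟨n - 1, Nat.sub_lt (NeZero.pos n) one_pos⟩ := by
  set A := pathMatrix (n * 2) (zeroExtend (pathWeights x y c)) with hA
  set t : Fin n := ⟨n - 1, Nat.sub_lt (NeZero.pos n) one_pos⟩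
  have h1 : (A ^ (2 * k)).submatrix (bipartitionEquiv n) (bipartitionEquiv n) =
      (A.submatrix (bipartitionEquiv n) (bipartitionEquiv n)) ^ (2 * k) :=
    map_pow (Matrix.reindexAlgEquiv ℝ ℝ (bipartitionEquiv n).symm) A (2 * k)
  have h2 : (0 : Fin (n * 2)) = bipartitionEquiv n (.inl t) := by
    change _ = bipartitionFun n (.inl t)
    ext
    simp [bipartitionFun, t]
  rw [pathMoment, zeroExtend_pathWeights_zero, ← hA]
  congr 1
  conv_lhs => rw [h2]
  rw [← Matrix.submatrix_apply (A ^ (2 * k)) (bipartitionEquiv n) (bipartitionEquiv n), h1, hA,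
    pathMatrix_submatrix_bipartition, pow_mul, sq, Matrix.fromBlocks_multiply]
  simp only [Matrix.zero_mul, Matrix.mul_zero, zero_add, add_zero]
  rw [Matrix.fromBlocks_diagonal_pow, Matrix.fromBlocks_apply₁₁]

end Weights

/-! ### The spectral measure of the tridiagonal matrix. -/

section Spectral

variable {n : ℕ}

theorem bidiagonal_neg (x : Fin n → ℝ) (y : Fin (n - 1) → ℝ) :
    bidiagonal x (-y) = Matrix.diagonal (fun i : Fin n => (-1 : ℝ) ^ (i : ℕ)) * bidiagonal x y *
      Matrix.diagonal (fun i : Fin n => (-1 : ℝ) ^ (i : ℕ)) := by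
  ext i j
  rw [Matrix.mul_diagonal, Matrix.diagonal_mul]
  unfold bidiagonal
  split_ifs with h1 h2
  · rw [h1, mul_right_comm, ← pow_add, Even.neg_one_pow ⟨_, rfl⟩, one_mul]
  · rw [mul_right_comm, ← pow_add, Odd.neg_one_pow ⟨j, by omega⟩]
    simp
  · ring

/-- Changing the sign of `y` is conjugation by the diagonal matrix of alternating signs, and BᵀB and
BBᵀ have the same characteristic polynomial. -/
theorem charpoly_bidiagonal_neg (x : Fin n → ℝ) (y : Fin (n - 1) → ℝ) :
    ((bidiagonal x (-y)).transpose * bidiagonal x (-y)).charpoly = (tridiagonal x y).charpoly := by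
  set D : Matrix (Fin n) (Fin n) ℝ := Matrix.diagonal (fun i : Fin n => (-1 : ℝ) ^ (i : ℕ)) with hD
  have hDD : D * D = 1 := by
    rw [hD, Matrix.diagonal_mul_diagonal, ← Matrix.diagonal_one]
    congr 1
    ext i
    rw [← pow_add, Even.neg_one_pow ⟨_, rfl⟩]
  have hDt : D.transpose = D := Matrix.diagonal_transpose _
  rw [Matrix.charpoly_mul_comm, bidiagonal_neg, ← hD, Matrix.transpose_mul, Matrix.transpose_mul,
    hDt]
  have : D * bidiagonal x y * D * (D * ((bidiagonal x y).transpose * D)) =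
      D * (tridiagonal x y * D) := by
    rw [tridiagonal]
    calc _ = D * bidiagonal x y * (D * D) * ((bidiagonal x y).transpose * D) := by
          simp only [Matrix.mul_assoc]
      _ = _ := by rw [hDD, Matrix.mul_one]; simp only [Matrix.mul_assoc]
  rw [this, Matrix.charpoly_mul_comm, Matrix.mul_assoc, hDD, Matrix.mul_one]

theorem orderedEigenvalues_monotone (x : Fin n → ℝ) (y : Fin (n - 1) → ℝ) :
    Monotone (orderedEigenvalues x y) := fun i j hij =>
  (tridiagonal_isHermitian x y).eigenvalues₀_antitone <| by
    rw [Fin.le_def]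
    simp only [Fin.val_cast, Fin.val_rev]
    omega

theorem exists_perm_eigenvalues_eq (x : Fin n → ℝ) (y : Fin (n - 1) → ℝ) :
    ∃ σ : Equiv.Perm (Fin n), ∀ i, (tridiagonal_isHermitian x y).eigenvalues (σ i) =
      orderedEigenvalues x y i :=
  ⟨Fin.revPerm.trans ((finCongr (Fintype.card_fin n).symm).trans
    (Fintype.equivOfCardEq (Fintype.card_fin _))), fun i => by
      simp [Matrix.IsHermitian.eigenvalues, orderedEigenvalues]⟩

theorem Matrix.IsHermitian.pow_apply_self {A : Matrix (Fin n) (Fin n) ℝ} (hA : A.IsHermitian)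
    (k : ℕ) (i : Fin n) : (A ^ k) i i =
      ∑ j, (hA.eigenvectorUnitary : Matrix (Fin n) (Fin n) ℝ) i j ^ 2 * hA.eigenvalues j ^ k := by
  conv_lhs => rw [hA.spectral_theorem, ← map_pow, Matrix.diagonal_pow,
    Unitary.conjStarAlgAut_apply, Matrix.mul_apply]
  refine Finset.sum_congr rfl fun j _ => ?_
  rw [Matrix.mul_diagonal]
  simp only [Pi.pow_apply, Function.comp_apply, RCLike.ofReal_real_eq_id, id_eq, Matrix.star_apply,
    star_trivial]
  ring

theorem Matrix.IsHermitian.trace_aeval {A : Matrix (Fin n) (Fin n) ℝ} (hA : A.IsHermitian)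
    (V : ℝ[X]) : (aeval A V).trace = ∑ j, V.eval (hA.eigenvalues j) := by
  have h : ∀ k, (A ^ k).trace = ∑ j, hA.eigenvalues j ^ k := fun k => by
    conv_lhs => rw [hA.spectral_theorem, ← map_pow, Matrix.diagonal_pow,
      Unitary.conjStarAlgAut_apply, Matrix.trace_mul_cycle, Unitary.coe_star_mul_self, one_mul]
    simp [Matrix.trace_diagonal]
  rw [aeval_eq_sum_range, Matrix.trace_sum]
  simp only [Matrix.trace_smul, h, eval_eq_sum_range, smul_eq_mul, Finset.mul_sum]
  exact Finset.sum_comm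

theorem trace_aeval_tridiagonal (x : Fin n → ℝ) (y : Fin (n - 1) → ℝ) (V : ℝ[X]) :
    (aeval (tridiagonal x y) V).trace = ∑ i, V.eval (orderedEigenvalues x y i) := by
  obtain ⟨σ, hσ⟩ := exists_perm_eigenvalues_eq x y
  rw [(tridiagonal_isHermitian x y).trace_aeval, ← Equiv.sum_comp σ]
  simp only [hσ]

variable [NeZero n]

/-- The spectral measure of a bidiagonal matrix with positive entries. -/
theorem exists_pointMoment_eq_pathMoment {x : Fin n → ℝ} {y : Fin (n - 1) → ℝ} {c : ℝ}
    (hx : ∀ i, 0 < x i) (hy : ∀ i, 0 < y i) (hc : 0 < c) :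
    StrictMono (orderedEigenvalues x y) ∧ (∀ i, 0 < orderedEigenvalues x y i) ∧
    ∃ w : Fin n → ℝ, (∀ i, 0 < w i) ∧ ∀ k, pointMoment (orderedEigenvalues x y) w k =
      pathMoment (n * 2) (zeroExtend (pathWeights x y c)) k := by
  set B := bidiagonal x (-y) with hB
  have hpos : (B.transpose * B).PosSemidef := by
    have := Matrix.posSemidef_conjTranspose_mul_self B
    rwa [Matrix.conjTranspose_eq_transpose_of_trivial] at this
  have hA := hpos.isHermitian
  obtain ⟨σ, hσ⟩ := exists_perm_eigenvalues_eq x y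
  rw [(Matrix.IsHermitian.eigenvalues_eq_eigenvalues_iff (tridiagonal_isHermitian x y) hA).2
    (charpoly_bidiagonal_neg x y).symm] at hσ
  set l := orderedEigenvalues x y
  set t : Fin n := ⟨n - 1, Nat.sub_lt (NeZero.pos n) one_pos⟩
  -- The squared last components of the orthonormal eigenvectors are the masses of the spectral
  -- measure. At this stage masses and eigenvalues are only known to be nonnegative.
  set w : Fin n → ℝ := fun i => c * (hA.eigenvectorUnitary : Matrix (Fin n) (Fin n) ℝ) t (σ i) ^ 2
  have hw0 : ∀ i, 0 ≤ w i := fun i => mul_nonneg hc.le (sq_nonneg _)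
  have hl0 : ∀ i, 0 ≤ l i := fun i => by rw [← hσ]; exact hpos.eigenvalues_nonneg _
  have hmom : ∀ k, pointMoment l w k =
      pathMoment (n * 2) (zeroExtend (pathWeights x y c)) k := by
    intro k
    rw [pathMoment_pathWeights, hA.pow_apply_self, ← Equiv.sum_comp σ, Finset.mul_sum]
    refine Finset.sum_congr rfl fun i _ => ?_
    rw [hσ, mul_assoc]
  set z := zeroExtend (pathWeights x y c) with hz
  have hzpos : ∀ k < n * 2, 0 < z k := fun k hk => by
    rw [hz, zeroExtend_of_lt _ hk]
    exact pathWeights_pos_iff.2 ⟨⟨hx, hy⟩, hc⟩ _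
  have hz0 : 0 < z 0 := hzpos 0 (by have := NeZero.pos n; omega)
  -- The Hankel determinants are positive on the path side. Read on the point side, the first forces
  -- nonzero masses and distinct eigenvalues, and the shifted one nonzero eigenvalues.
  have h0 : 0 < (∏ i, w i) * (Matrix.vandermonde l).det ^ 2 := by
    rw [← det_hankel_pointMoment]
    simp only [hmom]
    rw [det_hankel_pathMoment]
    refine mul_pos (pow_pos hz0 _) (Finset.prod_pos fun a _ => pow_pos (Finset.prod_pos
      fun i hi => hzpos _ ?_) 2)
    have := Finset.mem_range.1 hi
    omega
  have h1 : 0 < (∏ i, w i) * (∏ i, l i) * (Matrix.vandermonde l).det ^ 2 := by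
    rw [← det_hankel_succ_pointMoment]
    simp only [hmom]
    rw [det_hankel_succ_pathMoment]
    refine mul_pos (pow_pos hz0 _) (Finset.prod_pos fun a _ => pow_pos (Finset.prod_pos
      fun i hi => hzpos _ ?_) 2)
    have := Finset.mem_range.1 hi
    omega
  have hV : (Matrix.vandermonde l).det ≠ 0 := fun h => by simp [h] at h0
  refine ⟨(orderedEigenvalues_monotone x y).strictMono_of_injective
    (Matrix.det_vandermonde_ne_zero_iff.1 hV), fun i => (hl0 i).lt_of_ne' fun h => ?_, w,
    fun i => (hw0 i).lt_of_ne' fun h => ?_, hmom⟩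
  · rw [Finset.prod_eq_zero (f := l) (Finset.mem_univ i) h] at h1
    simp at h1
  · rw [Finset.prod_eq_zero (f := w) (Finset.mem_univ i) h] at h0
    simp at h0

end Spectral

/-! ### Tools for Jacobian determinants. -/

section Jacobian

theorem ContinuousLinearMap.det_eq_det_of {ι : Type*} [Fintype ι] [DecidableEq ι]
    (f : (ι → ℝ) →L[ℝ] (ι → ℝ)) :
    f.det = (Matrix.of fun i j => f (Pi.single j 1) i).det := by
  rw [ContinuousLinearMap.det, ← LinearMap.det_toMatrix']
  congr 1

theorem fderiv_single_apply {ι κ : Type*} [Fintype ι] [DecidableEq ι] [Fintype κ]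
    {F : (ι → ℝ) → (κ → ℝ)} {u : ι → ℝ} (hF : DifferentiableAt ℝ F u) (j : ι) (k : κ) :
    fderiv ℝ F u (Pi.single j 1) k = deriv (fun t => F (Function.update u j t) k) (u j) := by
  have h1 : HasDerivAt (fun t => F (Function.update u j t)) (fderiv ℝ F u (Pi.single j 1)) (u j) :=
    HasFDerivAt.comp_hasDerivAt (u j)
      (by rw [Function.update_eq_self]; exact hF.hasFDerivAt) (hasDerivAt_update u j (u j))
  exact ((hasDerivAt_pi.1 h1 k).deriv).symm

/-- Each unordered pair occurs twice. The inner product is the derivative at `l i` of the polynomial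
with zeros `l`, which is how it enters the confluent Vandermonde determinant. -/
theorem abs_prod_prod_sub {n : ℕ} (l : Fin n → ℝ) :
    |∏ i, ∏ j ∈ Finset.univ.erase i, (l i - l j)| = (Matrix.vandermonde l).det ^ 2 := by
  have h1 : ∀ i : Fin n, ∏ j ∈ Finset.univ.erase i, (l i - l j) =
      (∏ j ∈ Finset.Iio i, (l i - l j)) * ∏ j ∈ Finset.Ioi i, (l i - l j) := fun i => by
    rw [← Finset.prod_union]
    · refine Finset.prod_congr ?_ fun _ _ => rfl
      ext j
      simp [lt_or_lt_iff_ne]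
    · exact Finset.disjoint_left.2 fun j hj hj' =>
        lt_asymm (Finset.mem_Iio.1 hj) (Finset.mem_Ioi.1 hj')
  have h2 : ∏ i : Fin n, ∏ j ∈ Finset.Iio i, (l i - l j) = (Matrix.vandermonde l).det := by
    rw [Matrix.det_vandermonde]
    exact Finset.prod_comm' (by simp)
  simp only [h1, Finset.prod_mul_distrib]
  rw [h2, abs_mul, ← sq_abs, sq]
  congr 1
  rw [Matrix.det_vandermonde, Finset.abs_prod, Finset.abs_prod]
  refine Finset.prod_congr rfl fun i _ => ?_
  rw [Finset.abs_prod, Finset.abs_prod]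
  exact Finset.prod_congr rfl fun j _ => abs_sub_comm _ _

end Jacobian

/-! ### The Jacobian of masses and points ↦ moments. -/

section PointMap

variable {n : ℕ}

/-- The splitting of `Fin (n * 2)` into its lower and upper half. -/
def halvesEquiv (n : ℕ) : Fin n ⊕ Fin n ≃ Fin (n * 2) :=
  finSumFinEquiv.trans (finCongr (mul_two n).symm)

@[simp] theorem halvesEquiv_inl (i : Fin n) : (halvesEquiv n (.inl i) : ℕ) = i := by
  simp [halvesEquiv]

@[simp] theorem halvesEquiv_inr (i : Fin n) : (halvesEquiv n (.inr i) : ℕ) = n + i := by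
  simp [halvesEquiv, add_comm]

/-- The masses among the parameters of a point measure. -/
def massPart (u : Fin (n * 2) → ℝ) (i : Fin n) : ℝ := u (halvesEquiv n (.inl i))

/-- The points among the parameters of a point measure. -/
def pointPart (u : Fin (n * 2) → ℝ) (i : Fin n) : ℝ := u (halvesEquiv n (.inr i))

/-- The first `2 n` moments of an `n`-point measure. -/
def pointMap (u : Fin (n * 2) → ℝ) (k : Fin (n * 2)) : ℝ :=
  pointMoment (pointPart u) (massPart u) k

/-- The Jacobian matrix of `pointMap`. -/
def pointJacobian (u : Fin (n * 2) → ℝ) : Matrix (Fin (n * 2)) (Fin (n * 2)) ℝ :=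
  fun k s => Sum.elim (fun i => pointPart u i ^ (k : ℕ))
    (fun i => massPart u i * (k * pointPart u i ^ ((k : ℕ) - 1))) ((halvesEquiv n).symm s)

theorem hasFDerivAt_pointMap (u : Fin (n * 2) → ℝ) :
    HasFDerivAt pointMap (Matrix.toLin' (pointJacobian u)).toContinuousLinearMap u := by
  rw [hasFDerivAt_pi']
  intro k
  have h : HasFDerivAt (fun u : Fin (n * 2) → ℝ => ∑ i, massPart u i * pointPart u i ^ (k : ℕ))
      (∑ i, (massPart u i • (((k : ℕ) • pointPart u i ^ ((k : ℕ) - 1)) •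
        (ContinuousLinearMap.proj (halvesEquiv n (.inr i)) : (Fin (n * 2) → ℝ) →L[ℝ] ℝ)) +
        pointPart u i ^ (k : ℕ) •
          (ContinuousLinearMap.proj (halvesEquiv n (.inl i)) : (Fin (n * 2) → ℝ) →L[ℝ] ℝ))) u :=
    HasFDerivAt.fun_sum fun i _ => (hasFDerivAt_apply _ u).mul ((hasFDerivAt_apply _ u).pow _)
  refine h.congr_fderiv ?_
  ext v
  simp only [sum_apply, add_apply, smul_apply, ContinuousLinearMap.proj_apply, smul_eq_mul,
    ContinuousLinearMap.comp_apply, LinearMap.coe_toContinuousLinearMap', Matrix.toLin'_apply,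
    Matrix.mulVec, dotProduct]
  rw [← Equiv.sum_comp (halvesEquiv n), Fintype.sum_sum_type, ← Finset.sum_add_distrib]
  refine Finset.sum_congr rfl fun i _ => ?_
  simp only [pointJacobian, Equiv.symm_apply_apply, Sum.elim_inl, Sum.elim_inr, nsmul_eq_mul]
  ring

/-- A confluent Vandermonde determinant. Replace the monomials by the monic basis 1, …, X^{n-1}, P,
XP, …, X^{n-1}P, where P = ∏(X - l_i). This base change has determinant one. Since P vanishes at the
points, the matrix becomes block triangular with diagonal blocks V and diag(w_i P'(l_i)) V, where V
is the Vandermonde matrix. -/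
theorem abs_det_pointJacobian (u : Fin (n * 2) → ℝ) :
    |(pointJacobian u).det| =
      |∏ i, massPart u i| * (Matrix.vandermonde (pointPart u)).det ^ 4 := by
  set l := pointPart u
  set w := massPart u
  set P : ℝ[X] := ∏ i, (Polynomial.X - C (l i)) with hP
  have hPm : P.Monic := monic_prod_of_monic _ _ fun i _ => monic_X_sub_C _
  have hPd : P.natDegree = n := by rw [natDegree_prod_X_sub_C_le]; simp
  set q : Fin (n * 2) → ℝ[X] := fun k =>
    if (k : ℕ) < n then Polynomial.X ^ (k : ℕ) else Polynomial.X ^ ((k : ℕ) - n) * P with hq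
  have hqd : ∀ k, (q k).natDegree = k := fun k => by
    simp only [hq]
    split_ifs with h
    · exact natDegree_X_pow _
    · rw [(monic_X_pow _).natDegree_mul hPm, natDegree_X_pow, hPd]
      omega
  have hqm : ∀ k, (q k).Monic := fun k => by
    simp only [hq]
    split_ifs with h
    · exact monic_X_pow _
    · exact (monic_X_pow _).mul hPm
  have h1 := Matrix.det_matrixOfPolynomials q hqd hqm
  set T : Matrix (Fin (n * 2)) (Fin (n * 2)) ℝ := Matrix.of fun i j => (q j).coeff i with hT
  have hinl : ∀ i k, ((pointJacobian u).transpose * T) (halvesEquiv n (.inl i)) k =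
      (q k).eval (l i) := fun i k => by
    rw [Matrix.mul_apply, eval_eq_sum_range' (n := n * 2) (by rw [hqd]; exact k.isLt),
      Finset.sum_range]
    refine Finset.sum_congr rfl fun m _ => ?_
    simp only [Matrix.transpose_apply, pointJacobian, Equiv.symm_apply_apply, Sum.elim_inl, hT,
      Matrix.of_apply]
    ring
  have hinr : ∀ i k, ((pointJacobian u).transpose * T) (halvesEquiv n (.inr i)) k =
      w i * (derivative (q k)).eval (l i) := fun i k => by
    rw [Matrix.mul_apply, derivative_eval,
      sum_over_range' _ (by simp) (n * 2) (by rw [hqd]; exact k.isLt),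
      Finset.sum_range, Finset.mul_sum]
    refine Finset.sum_congr rfl fun m _ => ?_
    simp only [Matrix.transpose_apply, pointJacobian, Equiv.symm_apply_apply, Sum.elim_inr, hT,
      Matrix.of_apply]
    ring
  have hPl : ∀ i, P.eval (l i) = 0 := fun i => by
    rw [hP, eval_prod]
    exact Finset.prod_eq_zero (Finset.mem_univ i) (by simp)
  have hPl' : ∀ i, (derivative P).eval (l i) = ∏ j ∈ Finset.univ.erase i, (l i - l j) := fun i => by
    rw [hP, ← Finset.mul_prod_erase _ _ (Finset.mem_univ i), derivative_mul, derivative_X_sub_C,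
      eval_add, eval_mul, eval_mul, eval_prod]
    simp
  have hblock : ((pointJacobian u).transpose * T).submatrix (halvesEquiv n) (halvesEquiv n) =
      Matrix.fromBlocks (Matrix.vandermonde l) 0
        (Matrix.of fun i a : Fin n => w i * (derivative (q (halvesEquiv n (.inl a)))).eval (l i))
        (Matrix.diagonal (fun i => w i * ∏ j ∈ Finset.univ.erase i, (l i - l j)) *
          Matrix.vandermonde l) := by
    ext (i | i) (a | a)
    · rw [Matrix.submatrix_apply, hinl, Matrix.fromBlocks_apply₁₁]
      simp [hq, Matrix.vandermonde_apply]
    · rw [Matrix.submatrix_apply, hinl, Matrix.fromBlocks_apply₁₂]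
      simp [hq, hPl]
    · rw [Matrix.submatrix_apply, hinr, Matrix.fromBlocks_apply₂₁, Matrix.of_apply]
    · rw [Matrix.submatrix_apply, hinr, Matrix.fromBlocks_apply₂₂, Matrix.diagonal_mul,
        Matrix.vandermonde_apply]
      simp only [hq, halvesEquiv_inr, add_lt_iff_neg_left, not_lt_zero, if_false,
        Nat.add_sub_cancel_left, derivative_mul, eval_add, eval_mul, hPl, hPl', mul_zero, zero_add,
        eval_pow, eval_X]
      ring
  have h2 := congrArg Matrix.det hblock
  rw [Matrix.det_submatrix_equiv_self, Matrix.det_mul, Matrix.det_transpose, h1, mul_one,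
    Matrix.det_fromBlocks_zero₁₂, Matrix.det_mul, Matrix.det_diagonal,
    Finset.prod_mul_distrib] at h2
  rw [h2, abs_mul, abs_mul, abs_mul, abs_prod_prod_sub]
  have := sq_abs (Matrix.vandermonde l).det
  linear_combination (|∏ i, w i| * (Matrix.vandermonde l).det ^ 2) * this

theorem toContinuousLinearMap_toLin'_det {ι : Type*} [Fintype ι] [DecidableEq ι]
    (A : Matrix ι ι ℝ) : (Matrix.toLin' A).toContinuousLinearMap.det = A.det := by
  rw [ContinuousLinearMap.det, LinearMap.coe_toContinuousLinearMap, LinearMap.det_toLin']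

end PointMap

/-! ### The Jacobian of path weights ↦ moments. -/

section PathMap

variable {n : ℕ} [NeZero n]

/-- The first `2 n` moments belonging to given path weights. -/
def pathMap (u : Fin (n * 2) → ℝ) (k : Fin (n * 2)) : ℝ := pathMoment (n * 2) (zeroExtend u) k

theorem differentiable_zeroExtend {N : ℕ} (l : ℕ) :
    Differentiable ℝ fun u : Fin N → ℝ => zeroExtend u l := by
  unfold zeroExtend
  split_ifs with h
  · exact differentiable_apply _
  · exact differentiable_const _

theorem differentiable_pathMap : Differentiable ℝ (pathMap (n := n)) := by
  have h1 : ∀ i j, Differentiable ℝ fun u : Fin (n * 2) → ℝ =>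
      pathMatrix (n * 2) (zeroExtend u) i j := by
    intro i j
    unfold pathMatrix
    split_ifs
    · exact differentiable_zeroExtend _
    · exact differentiable_zeroExtend _
    · exact differentiable_const _
  have h2 : ∀ (k : ℕ) i j, Differentiable ℝ fun u : Fin (n * 2) → ℝ =>
      (pathMatrix (n * 2) (zeroExtend u) ^ k) i j := by
    intro k
    induction k with
    | zero => exact fun i j => by simp only [pow_zero]; exact differentiable_const _
    | succ k ih =>
      intro i j
      simp only [pow_succ, Matrix.mul_apply]
      exact Differentiable.fun_sum fun m _ => (ih i m).mul (h1 m j)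
  rw [differentiable_pi]
  exact fun k => (differentiable_zeroExtend 0).mul (h2 _ 0 0)

theorem zeroExtend_update {N : ℕ} (u : Fin N → ℝ) (j : Fin N) (t : ℝ) :
    zeroExtend (Function.update u j t) = Function.update (zeroExtend u) j t := by
  ext l
  by_cases hl : l < N
  · rw [zeroExtend_of_lt _ hl]
    by_cases hj : l = j
    · subst hj
      simp
    · rw [Function.update_of_ne (fun h => hj (congrArg Fin.val h)), Function.update_of_ne hj,
        zeroExtend_of_lt _ hl]
  · rw [Function.update_of_ne (by omega), zeroExtend, zeroExtend, dif_neg hl, dif_neg hl]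

theorem fderiv_pathMap_of_lt (u : Fin (n * 2) → ℝ) {k j : Fin (n * 2)} (h : k < j) :
    fderiv ℝ pathMap u (Pi.single j 1) k = 0 := by
  rw [fderiv_single_apply (differentiable_pathMap u)]
  have : (fun t => pathMap (Function.update u j t) k) = fun _ => pathMap u k := by
    ext t
    rw [pathMap, zeroExtend_update]
    exact pathMoment_congr k.isLt fun l hl => Function.update_of_ne (by omega) _ _
  rw [this, deriv_const]

/-- In its own weight the moment is linear for `k = 0` and a square plus a constant otherwise.
Multiplication by `u k` restores the leading term without dividing by a weight. -/
theorem fderiv_pathMap_self (u : Fin (n * 2) → ℝ) (k : Fin (n * 2)) :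
    fderiv ℝ pathMap u (Pi.single k 1) k * u k =
      (if (k : ℕ) = 0 then 1 else 2) *
        (u 0 * (∏ l ∈ Finset.range k, zeroExtend u (l + 1)) ^ 2) := by
  rw [fderiv_single_apply (differentiable_pathMap u)]
  obtain ⟨k, hk⟩ := k
  rcases k with _ | k
  · have : (fun t => pathMap (Function.update u ⟨0, hk⟩ t) ⟨0, hk⟩) = fun t => t := by
      ext t
      simp [pathMap, zeroExtend_update, pathMoment_zero]
    rw [this, deriv_id'']
    simp
  · set z := zeroExtend u with hz
    have hz0 : u 0 = z 0 := (zeroExtend_val u 0).symm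
    have hzk : u ⟨k + 1, hk⟩ = z (k + 1) := (zeroExtend_of_lt u hk).symm
    set A := z 0 * (∏ l ∈ Finset.range k, z (l + 1)) ^ 2 with hA
    have hpr : ∀ t, Function.update z (k + 1) t 0 *
        (∏ l ∈ Finset.range (k + 1), Function.update z (k + 1) t (l + 1)) ^ 2 = A * t ^ 2 := by
      intro t
      rw [Finset.prod_range_succ, Function.update_self, Function.update_of_ne (Nat.succ_ne_zero k).symm,
        Finset.prod_congr rfl fun l hl => Function.update_of_ne
          (by have := Finset.mem_range.1 hl; omega) t z, hA]
      ring
    have : (fun t => pathMap (Function.update u ⟨k + 1, hk⟩ t) ⟨k + 1, hk⟩) = fun t =>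
        A * t ^ 2 + (pathMoment (n * 2) z (k + 1) -
          z 0 * (∏ l ∈ Finset.range (k + 1), z (l + 1)) ^ 2) := by
      ext t
      rw [pathMap, zeroExtend_update, ← hz, ← hpr t]
      have := pathMoment_sub_eq (z := Function.update z (k + 1) t) (z' := z) hk fun l hl =>
        Function.update_of_ne hl.ne t z
      change pathMoment (n * 2) (Function.update z (k + 1) t) (k + 1) = _
      linarith
    have hd : HasDerivAt (fun t : ℝ => A * t ^ 2 + (pathMoment (n * 2) z (k + 1) -
          z 0 * (∏ l ∈ Finset.range (k + 1), z (l + 1)) ^ 2)) (A * (2 * z (k + 1))) (z (k + 1)) := by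
      simpa using ((hasDerivAt_pow 2 (z (k + 1))).const_mul A).add_const
        (pathMoment (n * 2) z (k + 1) - z 0 * (∏ l ∈ Finset.range (k + 1), z (l + 1)) ^ 2)
    rw [this, hzk, hd.deriv, if_neg (Nat.succ_ne_zero k), hz0, Finset.prod_range_succ, hA]
    ring

theorem det_fderiv_pathMap_mul_prod (u : Fin (n * 2) → ℝ) :
    (fderiv ℝ pathMap u).det * ∏ k, u k = 2 ^ (n * 2 - 1) *
      ∏ k : Fin (n * 2), (u 0 * (∏ l ∈ Finset.range k, zeroExtend u (l + 1)) ^ 2) := by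
  have htri : (Matrix.of fun i j => fderiv ℝ pathMap u (Pi.single j 1) i).IsLowerTriangular :=
    fun i j hij => fderiv_pathMap_of_lt u hij
  rw [ContinuousLinearMap.det_eq_det_of, Matrix.det_of_isLowerTriangular _ htri, ← Finset.prod_mul_distrib]
  simp only [Matrix.of_apply, fderiv_pathMap_self]
  rw [Finset.prod_mul_distrib]
  congr 1
  rw [← Finset.mul_prod_erase _ _ (Finset.mem_univ 0),
    Finset.prod_congr (g := fun _ => (2 : ℝ)) rfl fun k hk =>
      if_neg fun h => Finset.ne_of_mem_erase hk (Fin.ext (by simpa using h))]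
  simp

end PathMap

/-! ### Both parametrisations are injective with the same image. -/

section ChangeOfVariables

variable {n : ℕ}

/-- The parameters of point measures with positive masses at increasingly listed positive points. -/
def pointDomain (n : ℕ) : Set (Fin (n * 2) → ℝ) :=
  {u | (∀ i, 0 < massPart u i) ∧ StrictMono (pointPart u) ∧ ∀ i, 0 < pointPart u i}

theorem injOn_pointMap : Set.InjOn pointMap (pointDomain n) := by
  intro u hu v hv h
  obtain ⟨h1, h2⟩ := eq_and_eq_of_pointMoment_eq hu.2.1 hv.2.1 (fun i => (hu.1 i).ne')
    (fun i => (hv.1 i).ne') fun k hk => congrFun h ⟨k, hk⟩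
  ext s
  obtain ⟨i | i, rfl⟩ := (halvesEquiv n).surjective s
  · exact congrFun h2 i
  · exact congrFun h1 i

theorem measurableSet_strictMono (n : ℕ) : MeasurableSet {l : Fin n → ℝ | StrictMono l} := by
  have : {l : Fin n → ℝ | StrictMono l} = ⋂ i, ⋂ j, ⋂ _ : i < j, {l | l i < l j} := by
    ext l
    simp [StrictMono]
  rw [this]
  exact .iInter fun i => .iInter fun j => .iInter fun _ =>
    measurableSet_lt (measurable_pi_apply i) (measurable_pi_apply j)

theorem measurableSet_forall_pos (ι : Type*) [Countable ι] :
    MeasurableSet {u : ι → ℝ | ∀ i, 0 < u i} := by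
  simp only [Set.ofPred_forall]
  exact .iInter fun i => measurableSet_lt measurable_const (measurable_pi_apply i)

theorem measurable_massPart : Measurable (massPart (n := n)) :=
  measurable_pi_lambda _ fun _ => measurable_pi_apply _

theorem measurable_pointPart : Measurable (pointPart (n := n)) :=
  measurable_pi_lambda _ fun _ => measurable_pi_apply _

theorem measurableSet_pointDomain : MeasurableSet (pointDomain n) :=
  (measurable_massPart (measurableSet_forall_pos _)).inter
    ((measurable_pointPart (measurableSet_strictMono n)).inter
      (measurable_pointPart (measurableSet_forall_pos _)))

variable [NeZero n]

theorem injOn_pathMap : Set.InjOn pathMap {u : Fin (n * 2) → ℝ | ∀ k, 0 < u k} := by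
  intro u hu v hv h
  have hpos : ∀ u : Fin (n * 2) → ℝ, (∀ k, 0 < u k) → ∀ k < n * 2, 0 < zeroExtend u k :=
    fun u hu k hk => by rw [zeroExtend_of_lt _ hk]; exact hu _
  have := eq_of_pathMoment_eq (hpos u hu) (hpos v hv) fun k hk => congrFun h ⟨k, hk⟩
  ext k
  have hk := this k k.isLt
  rwa [zeroExtend_val, zeroExtend_val] at hk

theorem exists_pointDomain_pointMap_eq {x : Fin n → ℝ} {y : Fin (n - 1) → ℝ} {c : ℝ}
    (hx : ∀ i, 0 < x i) (hy : ∀ i, 0 < y i) (hc : 0 < c) :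
    ∃ u ∈ pointDomain n, pointPart u = orderedEigenvalues x y ∧
      pointMap u = pathMap (pathWeights x y c) := by
  obtain ⟨hl, hl0, w, hw, h⟩ := exists_pointMoment_eq_pathMoment hx hy hc
  set u : Fin (n * 2) → ℝ := Sum.elim w (orderedEigenvalues x y) ∘ (halvesEquiv n).symm with hu
  have h1 : massPart u = w := by
    ext i
    simp [massPart, hu]
  have h2 : pointPart u = orderedEigenvalues x y := by
    ext i
    simp [pointPart, hu]
  refine ⟨u, ⟨?_, ?_, ?_⟩, h2, ?_⟩
  · rwa [h1]
  · rwa [h2]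
  · rwa [h2]
  · ext k
    rw [pointMap, h1, h2, h]
    rfl

theorem exists_eq_pathWeights {u : Fin (n * 2) → ℝ} (hu : ∀ k, 0 < u k) :
    ∃ x y c, ((∀ i, 0 < x i) ∧ ∀ i, 0 < y i) ∧ 0 < c ∧ u = pathWeights x y c := by
  set x : Fin n → ℝ := fun i => u (siteEquiv n (.inl (.inl i)))
  set y : Fin (n - 1) → ℝ := fun i => u (siteEquiv n (.inl (.inr i)))
  set c : ℝ := u (siteEquiv n (.inr ()))
  have h : u = pathWeights x y c := by
    ext k
    obtain ⟨(s | s) | s, rfl⟩ := (siteEquiv n).surjective k <;> simp [pathWeights, x, y, c]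
  have hpos := pathWeights_pos_iff.1 (fun l => (congrFun h l).symm ▸ hu l :
    ∀ l, 0 < pathWeights x y c l)
  exact ⟨x, y, c, hpos.1, hpos.2, h⟩

/-- One inclusion is the spectral theorem for the bidiagonal matrix, the other the successive
construction of the weights from the moments. -/
theorem pathMap_image_eq : pathMap '' {u : Fin (n * 2) → ℝ | ∀ k, 0 < u k} =
    pointMap '' pointDomain n := by
  ext m
  constructor
  · rintro ⟨u, hu, rfl⟩
    obtain ⟨x, y, c, hxy, hc, rfl⟩ := exists_eq_pathWeights hu
    obtain ⟨v, hv, -, h⟩ := exists_pointDomain_pointMap_eq hxy.1 hxy.2 hc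
    exact ⟨v, hv, h⟩
  · rintro ⟨u, hu, rfl⟩
    obtain ⟨z, hz, h⟩ := exists_pathMoment_eq_pointMoment hu.2.1.injective hu.2.2 hu.1
    refine ⟨fun k => z k, fun k => hz k k.isLt, ?_⟩
    ext k
    rw [pointMap, ← h k k.isLt]
    exact pathMoment_congr k.isLt fun l hl => zeroExtend_of_lt _ (hl.trans_lt k.isLt)

/-- Both sides are the integral of `G` over the common image in moment space. `G` may be arbitrary,
so a nonmeasurable inverse can be used inside it. -/
theorem lintegral_pointDomain_eq (G : (Fin (n * 2) → ℝ) → ℝ≥0∞) :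
    ∫⁻ u in pointDomain n, ENNReal.ofReal |(pointJacobian u).det| * G (pointMap u) =
      ∫⁻ u in {u : Fin (n * 2) → ℝ | ∀ k, 0 < u k},
        ENNReal.ofReal |(fderiv ℝ pathMap u).det| * G (pathMap u) := by
  rw [← lintegral_image_eq_lintegral_abs_det_fderiv_mul volume (measurableSet_forall_pos _)
    (fun u _ => (differentiable_pathMap u).hasFDerivAt.hasFDerivWithinAt) injOn_pathMap,
    pathMap_image_eq, lintegral_image_eq_lintegral_abs_det_fderiv_mul volume
      measurableSet_pointDomain (fun u _ => (hasFDerivAt_pointMap u).hasFDerivWithinAt)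
      injOn_pointMap]
  simp only [toContinuousLinearMap_toLin'_det]

end ChangeOfVariables

/-! ### Matching the two densities through Hankel determinants. -/

section Weights

theorem prod_range_two_mul {M : Type*} [CommMonoid M] (f : ℕ → M) (a : ℕ) :
    ∏ l ∈ Finset.range (2 * a), f l = ∏ m ∈ Finset.range a, (f (2 * m) * f (2 * m + 1)) := by
  induction a with
  | zero => simp
  | succ a ih =>
    rw [mul_add, mul_one, Finset.prod_range_succ, Finset.prod_range_succ, ih,
      Finset.prod_range_succ _ a, mul_assoc]

theorem prod_range_prod_range {M : Type*} [CommMonoid M] (f : ℕ → M) (n : ℕ) :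
    ∏ a ∈ Finset.range n, ∏ m ∈ Finset.range a, f m =
      ∏ m ∈ Finset.range n, f m ^ (n - 1 - m) := by
  induction n with
  | zero => simp
  | succ n ih =>
    rw [Finset.prod_range_succ, ih, ← Finset.prod_mul_distrib, Finset.prod_range_succ _ n,
      Nat.add_sub_cancel, Nat.sub_self, pow_zero, mul_one]
    refine Finset.prod_congr rfl fun m hm => ?_
    rw [← pow_succ]
    congr 1
    have := Finset.mem_range.1 hm
    omega

theorem prod_fin_mul_two {n : ℕ} (f : Fin (n * 2) → ℝ) :
    ∏ i, f i = (∏ a : Fin n, f ⟨2 * a, by omega⟩) * ∏ a : Fin n, f ⟨2 * a + 1, by omega⟩ := by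
  rw [← finProdFinEquiv.prod_comp, Fintype.prod_prod_type, ← Finset.prod_mul_distrib]
  refine Finset.prod_congr rfl fun a _ => ?_
  rw [Fin.prod_univ_two]
  congr 2 <;> ext <;> simp [finProdFinEquiv, add_comm]

theorem prod_prod_abs_sub_rpow {n : ℕ} (l : Fin n → ℝ) (β : ℝ) :
    ∏ i : Fin n, ∏ j ∈ Finset.Ioi i, |l i - l j| ^ β = |(Matrix.vandermonde l).det| ^ β := by
  rw [Matrix.det_vandermonde, Finset.abs_prod, ← Real.finsetProd_rpow _ _ fun i _ => abs_nonneg _]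
  refine Finset.prod_congr rfl fun i _ => ?_
  rw [Finset.abs_prod, ← Real.finsetProd_rpow _ _ fun i _ => abs_nonneg _]
  exact Finset.prod_congr rfl fun j _ => by rw [abs_sub_comm]

variable {n : ℕ} [NeZero n] {x : Fin n → ℝ} {y : Fin (n - 1) → ℝ} {c : ℝ}

theorem prod_pathWeights : ∏ k, pathWeights x y c k = (∏ i, x i) * (∏ i, y i) * c := by
  rw [← Equiv.prod_comp (siteEquiv n), Fintype.prod_sum_type, Fintype.prod_sum_type]
  simp [pathWeights]

/-- The weights z_{2m+1} and z_{2m+2} occur once for each `a > m`, hence `n - 1 - m` times. In the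
bottom-to-top order x_i has m = n - 1 - i and y_i has m = n - 2 - i, which gives the exponents `i`
and `i + 1`. -/
theorem prod_prod_range_even :
    ∏ a : Fin n, ∏ l ∈ Finset.range (2 * a), zeroExtend (pathWeights x y c) (l + 1) =
      (∏ i, x i ^ (i : ℕ)) * ∏ i, y i ^ ((i : ℕ) + 1) := by
  set z := zeroExtend (pathWeights x y c) with hz
  have hn : 0 < n := NeZero.pos n
  rw [Finset.prod_congr rfl fun a _ => prod_range_two_mul _ _,
    ← Finset.prod_range fun a => ∏ m ∈ Finset.range a, (z (2 * m + 1) * z (2 * m + 1 + 1)),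
    prod_range_prod_range]
  simp only [mul_pow]
  rw [Finset.prod_mul_distrib]
  congr 1
  · rw [← Finset.prod_range_reflect, Finset.prod_range]
    refine Finset.prod_congr rfl fun i _ => ?_
    rw [hz, zeroExtend_pathWeights_odd]
    congr 1
    omega
  · obtain ⟨m, rfl⟩ := Nat.exists_eq_succ_of_ne_zero hn.ne'
    simp only [Nat.succ_eq_add_one, Nat.add_sub_cancel] at *
    rw [Finset.prod_range_succ, Nat.sub_self, pow_zero, mul_one, ← Finset.prod_range_reflect,
      Finset.prod_range]
    refine Finset.prod_congr rfl fun i _ => ?_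
    have h1 := zeroExtend_pathWeights_even (x := x) (y := y) (c := c) i
    rw [← h1, ← hz]
    congr 1
    · congr 1
      omega
    · omega

theorem prod_prod_range_odd :
    ∏ a : Fin n, ∏ l ∈ Finset.range (2 * a + 1), zeroExtend (pathWeights x y c) (l + 1) =
      (∏ a : Fin n, ∏ l ∈ Finset.range (2 * a), zeroExtend (pathWeights x y c) (l + 1)) *
        ∏ i, x i := by
  simp only [Finset.prod_range_succ, Finset.prod_mul_distrib]
  congr 1
  rw [← Equiv.prod_comp Fin.revPerm]
  refine Finset.prod_congr rfl fun i _ => ?_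
  rw [← zeroExtend_pathWeights_odd (x := x) (y := y) (c := c) i]
  congr 2
  rw [Fin.revPerm_apply, Fin.val_rev]
  omega

variable {v : Fin (n * 2) → ℝ}

theorem sum_massPart_eq (hm : pointMap v = pathMap (pathWeights x y c)) :
    ∑ i, massPart v i = c := by
  have h := congrFun hm 0
  rw [pointMap, pathMap, Fin.val_zero, pathMoment_zero, zeroExtend_pathWeights_zero] at h
  simpa [pointMoment] using h

/-- The Hankel determinant of the common moments, evaluated on both sides. -/
theorem prod_massPart_mul_vandermonde_sq (hm : pointMap v = pathMap (pathWeights x y c)) :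
    (∏ i, massPart v i) * (Matrix.vandermonde (pointPart v)).det ^ 2 =
      c ^ n * ((∏ i, x i ^ (i : ℕ)) * ∏ i, y i ^ ((i : ℕ) + 1)) ^ 2 := by
  rw [← det_hankel_pointMoment, ← prod_prod_range_even (x := x) (c := c), ← Finset.prod_pow]
  have := det_hankel_pathMoment (n := n) (zeroExtend (pathWeights x y c))
  rw [zeroExtend_pathWeights_zero] at this
  rw [← this]
  congr 2
  ext a b
  exact congrFun hm ⟨a + b, by omega⟩

/-- Quotient of the shifted Hankel determinant by the unshifted one, on both sides. -/
theorem prod_pointPart_eq (hx : ∀ i, 0 < x i) (hy : ∀ i, 0 < y i) (hc : 0 < c)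
    (hm : pointMap v = pathMap (pathWeights x y c)) :
    ∏ i, pointPart v i = ∏ i, x i ^ 2 := by
  have h1 := prod_massPart_mul_vandermonde_sq hm
  have h2 := det_hankel_succ_pointMoment (pointPart v) (massPart v)
  have h3 := det_hankel_succ_pathMoment (n := n) (zeroExtend (pathWeights x y c))
  have h4 : (Matrix.of fun a b : Fin n => pointMoment (pointPart v) (massPart v) (a + b + 1)) =
      Matrix.of fun a b : Fin n => pathMoment (n * 2) (zeroExtend (pathWeights x y c))
        (a + b + 1) := by
    ext a b
    exact congrFun hm ⟨a + b + 1, by omega⟩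
  rw [h4, h3, zeroExtend_pathWeights_zero, Finset.prod_pow, prod_prod_range_odd,
    prod_prod_range_even] at h2
  rw [Finset.prod_pow]
  have hpos : 0 < c ^ n * ((∏ i, x i ^ (i : ℕ)) * ∏ i, y i ^ ((i : ℕ) + 1)) ^ 2 :=
    mul_pos (pow_pos hc n) <| pow_pos (mul_pos (Finset.prod_pos fun i _ => pow_pos (hx i) _)
      (Finset.prod_pos fun i _ => pow_pos (hy i) _)) 2
  refine mul_left_cancel₀ hpos.ne' ?_
  linear_combination -h2 - (∏ i, pointPart v i) * h1

/-- With A = ∏ x_i^i ∏ y_i^{i+1} (indices from zero), the even and odd leading terms multiply to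
c^{2n} A⁴ (∏x)². By the Hankel identities this is (∏w · Δ²)² ∏l, that is, ∏w · Δ⁴ times ∏w · ∏l. -/
theorem abs_det_fderiv_pathMap_mul (hx : ∀ i, 0 < x i) (hy : ∀ i, 0 < y i) (hc : 0 < c)
    (hm : pointMap v = pathMap (pathWeights x y c)) (hv : v ∈ pointDomain n) :
    |(fderiv ℝ pathMap (pathWeights x y c)).det| * ((∏ i, x i) * (∏ i, y i) * c) =
      2 ^ (n * 2 - 1) * |(pointJacobian v).det| *
        ((∏ i, massPart v i) * ∏ i, pointPart v i) := by
  have h1 := det_fderiv_pathMap_mul_prod (pathWeights x y c)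
  have h0 : pathWeights x y c 0 = c := pathWeights_siteFun (.inr ())
  rw [prod_pathWeights, prod_fin_mul_two, h0] at h1
  simp only [Finset.prod_mul_distrib, Finset.prod_pow, Finset.prod_const, Finset.card_univ,
    Fintype.card_fin, prod_prod_range_odd, prod_prod_range_even] at h1
  have h2 := prod_massPart_mul_vandermonde_sq hm
  have h3 := prod_pointPart_eq hx hy hc hm
  have hxyc : 0 < (∏ i, x i) * (∏ i, y i) * c := mul_pos (mul_pos
    (Finset.prod_pos fun i _ => hx i) (Finset.prod_pos fun i _ => hy i)) hc
  have h4 := congrArg abs h1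
  rw [abs_mul, abs_of_pos hxyc] at h4
  rw [h4, abs_det_pointJacobian, abs_of_pos (Finset.prod_pos fun i _ => hv.1 i), abs_of_nonneg]
  · rw [h3, Finset.prod_pow]
    set A := (∏ i, x i ^ (i : ℕ)) * ∏ i, y i ^ ((i : ℕ) + 1)
    set W := ∏ i, massPart v i
    set D := (Matrix.vandermonde (pointPart v)).det
    linear_combination -(2 ^ (n * 2 - 1) * (∏ i, x i) ^ 2 * (W * D ^ 2 + c ^ n * A ^ 2)) * h2
  · refine mul_nonneg (by positivity) (mul_nonneg (mul_nonneg (by positivity) (by positivity))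
      (mul_nonneg (by positivity) (by positivity)))

/-- The densities of the two models, with masses added, match up to the Jacobians. -/
theorem weight_identity {β a : ℝ} {V : ℝ[X]} (hx : ∀ i, 0 < x i) (hy : ∀ i, 0 < y i) (hc : 0 < c)
    (hv : v ∈ pointDomain n) (hl : pointPart v = orderedEigenvalues x y)
    (hm : pointMap v = pathMap (pathWeights x y c)) :
    |(fderiv ℝ pathMap (pathWeights x y c)).det| * (ensembleWeight n β a V (pointPart v) *
        ∏ i, (massPart v i ^ (β / 2 - 1) * Real.exp (-massPart v i))) =
      2 ^ (n * 2 - 1) * |(pointJacobian v).det| *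
        (modelWeight n β a V (x, y) * (c ^ (n * β / 2 - 1) * Real.exp (-c))) := by
  have hX : 0 < ∏ i, x i := Finset.prod_pos fun i _ => hx i
  have hY : 0 < ∏ i, y i := Finset.prod_pos fun i _ => hy i
  have hW : 0 < ∏ i, massPart v i := Finset.prod_pos fun i _ => hv.1 i
  have hL : 0 < ∏ i, pointPart v i := Finset.prod_pos fun i _ => hv.2.2 i
  have h1 := abs_det_fderiv_pathMap_mul hx hy hc hm hv
  have hexp : Real.exp (-(n * β * (aeval (tridiagonal x y) V).trace)) =
      ∏ i, Real.exp (-(β * n * V.eval (pointPart v i))) := by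
    rw [← Real.exp_sum, trace_aeval_tridiagonal, ← hl, Finset.mul_sum, ← Finset.sum_neg_distrib]
    exact congrArg _ (Finset.sum_congr rfl fun i _ => by ring)
  -- The Hankel identity raised to the power β/2, times `∏ l = ∏ x²` raised to β/2 · (a + 1). The
  -- exponent of x_i becomes β i + β (a + 1), with indices from zero.
  have hpow : |(Matrix.vandermonde (pointPart v)).det| ^ β * (∏ i, massPart v i) ^ (β / 2) *
      (∏ i, pointPart v i) ^ (β / 2 * (a + 1)) =
      c ^ (n * β / 2) * (∏ i : Fin n, x i ^ (β * (((i : ℕ) + 1 : ℝ) + a))) *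
        ∏ i : Fin (n - 1), y i ^ (β * ((i : ℕ) + 1 : ℝ)) := by
    have h2 : |(Matrix.vandermonde (pointPart v)).det| ^ β =
        ((Matrix.vandermonde (pointPart v)).det ^ 2) ^ (β / 2) := by
      rw [← sq_abs, ← Real.rpow_natCast_mul (abs_nonneg _)]
      congr 1
      push_cast
      ring
    have hxp : 0 < ∏ i, x i ^ (i : ℕ) := Finset.prod_pos fun i _ => pow_pos (hx i) _
    have hyp : 0 < ∏ i, y i ^ ((i : ℕ) + 1) := Finset.prod_pos fun i _ => pow_pos (hy i) _
    rw [h2, mul_comm (_ ^ (β / 2)), ← Real.mul_rpow hW.le (sq_nonneg _),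
      prod_massPart_mul_vandermonde_sq hm, prod_pointPart_eq hx hy hc hm,
      Real.mul_rpow (pow_pos hc n).le (sq_nonneg _), mul_pow,
      Real.mul_rpow (sq_nonneg _) (sq_nonneg _), ← Finset.prod_pow, ← Finset.prod_pow,
      ← Real.finsetProd_rpow _ _ fun i _ => sq_nonneg _,
      ← Real.finsetProd_rpow _ _ fun i _ => sq_nonneg _,
      ← Real.finsetProd_rpow _ _ fun i _ => sq_nonneg _, ← Real.rpow_natCast_mul hc.le,
      mul_div_assoc, mul_assoc, mul_assoc, mul_assoc]
    congr 1
    rw [mul_comm (∏ i, ((y i ^ ((i : ℕ) + 1)) ^ 2) ^ (β / 2)), ← mul_assoc,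
      ← Finset.prod_mul_distrib]
    congr 1
    · refine Finset.prod_congr rfl fun i _ => ?_
      rw [← pow_mul, ← Real.rpow_natCast_mul (hx i).le, ← Real.rpow_natCast_mul (hx i).le,
        ← Real.rpow_add (hx i)]
      congr 1
      push_cast
      ring
    · refine Finset.prod_congr rfl fun i _ => ?_
      rw [← pow_mul, ← Real.rpow_natCast_mul (hy i).le]
      congr 1
      push_cast
      ring
  have hsub : ∀ {ι : Type} [Fintype ι] {f : ι → ℝ} {r : ι → ℝ}, (∀ i, 0 < f i) →
      ∏ i, f i ^ (r i - 1) = (∏ i, f i ^ r i) / ∏ i, f i := fun {ι} _ {f r} hf => by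
    rw [← Finset.prod_div_distrib]
    exact Finset.prod_congr rfl fun i _ => Real.rpow_sub_one (hf i).ne' _
  unfold ensembleWeight modelWeight
  simp only
  rw [hexp, prod_prod_abs_sub_rpow, Finset.prod_mul_distrib, Finset.prod_mul_distrib, hsub hx,
    hsub hy, hsub hv.1, hsub hv.2.2, Real.finsetProd_rpow _ _ fun i _ => (hv.1 i).le,
    Real.finsetProd_rpow _ _ fun i _ => (hv.2.2 i).le, Real.rpow_sub_one hc.ne', ← Real.exp_sum _
      (fun i => -massPart v i), Finset.sum_neg_distrib, sum_massPart_eq hm]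
  set E := ∏ i, Real.exp (-(β * n * V.eval (pointPart v i)))
  set dP := |(fderiv ℝ pathMap (pathWeights x y c)).det|
  set dQ := |(pointJacobian v).det|
  have hdP : dP = 2 ^ (n * 2 - 1) * dQ * ((∏ i, massPart v i) * ∏ i, pointPart v i) /
      ((∏ i, x i) * (∏ i, y i) * c) := by
    rw [eq_div_iff (by positivity), h1]
  rw [hdP]
  generalize (∏ i, pointPart v i) ^ (β / 2 * (a + 1)) = r₁ at hpow ⊢
  generalize c ^ (n * β / 2) = r₂ at hpow ⊢
  field_simp
  linear_combination E * dQ * hpow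

end Weights

/-! ### Product densities and measure-preserving splittings of coordinates. -/

section ProductMeasures

theorem lintegral_fin_prod_eq_prod {n : ℕ} (μ : Fin n → Measure ℝ) [∀ i, SigmaFinite (μ i)]
    {f : Fin n → ℝ → ℝ≥0∞} (hf : ∀ i, Measurable (f i)) :
    ∫⁻ w, ∏ i, f i (w i) ∂Measure.pi μ = ∏ i, ∫⁻ t, f i t ∂μ i := by
  induction n with
  | zero => simp
  | succ n ih =>
    have hmp := (measurePreserving_piFinSuccAbove μ 0).symm
    have hfm : Measurable fun w : Fin (n + 1) → ℝ => ∏ i, f i (w i) :=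
      Finset.measurable_prod _ fun i _ => (hf i).comp (measurable_pi_apply i)
    have hfm' : Measurable fun w : Fin n → ℝ => ∏ i : Fin n, f i.succ (w i) :=
      Finset.measurable_prod _ fun i _ => (hf i.succ).comp (measurable_pi_apply i)
    rw [← hmp.lintegral_comp hfm, Fin.prod_univ_succ, ← ih (fun i => μ i.succ) fun i => hf i.succ,
      ← lintegral_prod_mul (hf 0).aemeasurable hfm'.aemeasurable]
    refine lintegral_congr fun p => ?_
    rw [Fin.prod_univ_succ]
    rfl

theorem pi_withDensity {n : ℕ} (μ : Fin n → Measure ℝ) [∀ i, SigmaFinite (μ i)]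
    {f : Fin n → ℝ → ℝ≥0∞} (hf : ∀ i, Measurable (f i))
    [∀ i, SigmaFinite ((μ i).withDensity (f i))] :
    Measure.pi (fun i => (μ i).withDensity (f i)) =
      (Measure.pi μ).withDensity fun w => ∏ i, f i (w i) := by
  refine Measure.pi_eq fun s hs => ?_
  rw [withDensity_apply _ (MeasurableSet.univ_pi hs), Measure.restrict_pi_pi,
    lintegral_fin_prod_eq_prod _ hf]
  exact Finset.prod_congr rfl fun i _ => (withDensity_apply _ (hs i)).symm

theorem restrict_forall_pos (ι : Type*) [Fintype ι] :
    (volume : Measure (ι → ℝ)).restrict {u | ∀ i, 0 < u i} =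
      Measure.pi fun _ => volume.restrict (Set.Ioi 0) := by
  rw [← Measure.restrict_pi_pi, ← volume_pi]
  congr 1
  ext u
  simp

variable {ι κ μ : Type*}

/-- Functions on an index set which is split in two, as pairs of functions. -/
def splitEquiv (e : ι ⊕ κ ≃ μ) : (μ → ℝ) ≃ᵐ (ι → ℝ) × (κ → ℝ) :=
  (MeasurableEquiv.piCongrLeft (fun _ => ℝ) e).symm.trans
    (MeasurableEquiv.sumPiEquivProdPi fun _ => ℝ)

variable [Fintype ι] [Fintype κ] [Fintype μ]

theorem measurePreserving_splitEquiv (e : ι ⊕ κ ≃ μ) :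
    MeasurePreserving (splitEquiv e) volume volume :=
  (volume_measurePreserving_sumPiEquivProdPi fun _ => ℝ).comp
    (volume_measurePreserving_piCongrLeft (fun _ => ℝ) e).symm

end ProductMeasures

/-! ### Transfer of integrals between bidiagonal matrices and spectra. -/

section Transfer

variable {n : ℕ}

/-- The unnormalized law of the masses. -/
noncomputable def massWeight (n : ℕ) (β : ℝ) (w : Fin n → ℝ) : ℝ :=
  ∏ i, (w i ^ (β / 2 - 1) * Real.exp (-w i))

theorem ensembleWeight_nonneg {β a : ℝ} {V : ℝ[X]} {l : Fin n → ℝ} (hl : ∀ i, 0 < l i) :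
    0 ≤ ensembleWeight n β a V l :=
  mul_nonneg (Finset.prod_nonneg fun _ _ => Finset.prod_nonneg fun _ _ =>
    Real.rpow_nonneg (abs_nonneg _) _) (Finset.prod_nonneg fun i _ =>
      mul_nonneg (Real.rpow_nonneg (hl i).le _) (Real.exp_nonneg _))

theorem massWeight_pos {β : ℝ} {w : Fin n → ℝ} (hw : ∀ i, 0 < w i) : 0 < massWeight n β w :=
  Finset.prod_pos fun i _ => mul_pos (Real.rpow_pos_of_pos (hw i) _) (Real.exp_pos _)

/-- The pairs of positive vectors. -/
def modelDomain (n : ℕ) : Set ((Fin n → ℝ) × (Fin (n - 1) → ℝ)) :=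
  {p | (∀ k, 0 < p.1 k) ∧ ∀ k, 0 < p.2 k}

theorem modelWeight_pos {β a : ℝ} {V : ℝ[X]} {p : (Fin n → ℝ) × (Fin (n - 1) → ℝ)}
    (hp : p ∈ modelDomain n) : 0 < modelWeight n β a V p :=
  mul_pos (mul_pos (Real.exp_pos _) (Finset.prod_pos fun k _ => Real.rpow_pos_of_pos (hp.1 k) _))
    (Finset.prod_pos fun k _ => Real.rpow_pos_of_pos (hp.2 k) _)

theorem measurableSet_modelDomain : MeasurableSet (modelDomain n) :=
  (measurable_fst (measurableSet_forall_pos _)).inter (measurable_snd (measurableSet_forall_pos _))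

theorem abs_det_pointJacobian_pos {u : Fin (n * 2) → ℝ} (hu : u ∈ pointDomain n) :
    0 < |(pointJacobian u).det| := by
  rw [abs_det_pointJacobian, abs_of_pos (Finset.prod_pos fun i _ => hu.1 i)]
  have h : (Matrix.vandermonde (pointPart u)).det ≠ 0 :=
    Matrix.det_vandermonde_ne_zero_iff.2 hu.2.1.injective
  exact mul_pos (Finset.prod_pos fun i _ => hu.1 i) (by positivity)

variable [NeZero n]

/-- The path weights as a triple of diagonal entries, subdiagonal entries and a mass. -/
noncomputable def weightsEquiv (n : ℕ) [NeZero n] :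
    (Fin (n * 2) → ℝ) ≃ᵐ ((Fin n → ℝ) × (Fin (n - 1) → ℝ)) × ℝ :=
  (splitEquiv (siteEquiv n)).trans
    ((splitEquiv (Equiv.refl _)).prodCongr (MeasurableEquiv.funUnique Unit ℝ))

theorem measurePreserving_weightsEquiv :
    MeasurePreserving (weightsEquiv n) volume volume :=
  ((measurePreserving_splitEquiv _).prod (volume_preserving_funUnique Unit ℝ)).comp
    (measurePreserving_splitEquiv _)

theorem weightsEquiv_pathWeights (x : Fin n → ℝ) (y : Fin (n - 1) → ℝ) (c : ℝ) :
    weightsEquiv n (pathWeights x y c) = ((x, y), c) := by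
  refine Prod.ext (Prod.ext (funext fun i => ?_) (funext fun i => ?_)) ?_
  · exact pathWeights_siteFun (.inl (.inl i))
  · exact pathWeights_siteFun (.inl (.inr i))
  · exact pathWeights_siteFun (.inr ())

/-- The change of variables is applied to the enlarged ensemble density divided by the Jacobian of
`pointMap`, read as a function of the moments. On the point side the Jacobian cancels, on the path
side `weight_identity` produces the model density. -/
theorem lintegral_pointDomain_eq_lintegral_pos {β a : ℝ} {V : ℝ[X]} (g : (Fin n → ℝ) → ℝ≥0∞) :
    ∫⁻ u in pointDomain n, ENNReal.ofReal (massWeight n β (massPart u)) *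
        (ENNReal.ofReal (ensembleWeight n β a V (pointPart u)) * g (pointPart u)) =
      ∫⁻ u in {u : Fin (n * 2) → ℝ | ∀ k, 0 < u k}, 2 ^ (n * 2 - 1) *
        ((ENNReal.ofReal (modelWeight n β a V (weightsEquiv n u).1) *
          g (orderedEigenvalues (weightsEquiv n u).1.1 (weightsEquiv n u).1.2)) *
        ENNReal.ofReal ((weightsEquiv n u).2 ^ (n * β / 2 - 1) *
          Real.exp (-(weightsEquiv n u).2))) := by
  set S : (Fin (n * 2) → ℝ) → (Fin (n * 2) → ℝ) := Function.invFunOn pointMap (pointDomain n)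
  have hS : ∀ u ∈ pointDomain n, S (pointMap u) = u := fun u hu =>
    injOn_pointMap.leftInvOn_invFunOn hu
  have key := lintegral_pointDomain_eq (n := n) fun m =>
    ENNReal.ofReal (ensembleWeight n β a V (pointPart (S m)) * massWeight n β (massPart (S m)) /
      |(pointJacobian (S m)).det|) * g (pointPart (S m))
  rw [setLIntegral_congr_fun measurableSet_pointDomain (g := fun u =>
      ENNReal.ofReal (massWeight n β (massPart u)) *
        (ENNReal.ofReal (ensembleWeight n β a V (pointPart u)) * g (pointPart u))),
    setLIntegral_congr_fun (measurableSet_forall_pos _) (g := fun u => 2 ^ (n * 2 - 1) *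
        ((ENNReal.ofReal (modelWeight n β a V (weightsEquiv n u).1) *
          g (orderedEigenvalues (weightsEquiv n u).1.1 (weightsEquiv n u).1.2)) *
        ENNReal.ofReal ((weightsEquiv n u).2 ^ (n * β / 2 - 1) *
          Real.exp (-(weightsEquiv n u).2))))] at key
  · exact key
  · intro u hu
    obtain ⟨x, y, c, hxy, hc, rfl⟩ := exists_eq_pathWeights hu
    obtain ⟨v, hv, hl, hm⟩ := exists_pointDomain_pointMap_eq hxy.1 hxy.2 hc
    have hM := modelWeight_pos (β := β) (a := a) (V := V) (p := (x, y)) hxy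
    simp only [weightsEquiv_pathWeights]
    rw [← hm, hS v hv, hl, ← mul_assoc, ← ENNReal.ofReal_mul (abs_nonneg _), mul_right_comm _ (g _),
      ← mul_assoc, ← ENNReal.ofReal_mul hM.le]
    congr 1
    have h2 : (2 : ℝ≥0∞) ^ (n * 2 - 1) = ENNReal.ofReal (2 ^ (n * 2 - 1)) := by
      rw [ENNReal.ofReal_pow zero_le_two, ENNReal.ofReal_ofNat]
    rw [h2, ← ENNReal.ofReal_mul (by positivity), ← mul_div_assoc]
    congr 1
    rw [div_eq_iff (abs_det_pointJacobian_pos hv).ne', ← hl]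
    have := weight_identity (β := β) (a := a) (V := V) hxy.1 hxy.2 hc hv hl hm
    rw [massWeight, this]
    ring
  · intro u hu
    simp only
    have hE := ensembleWeight_nonneg (β := β) (a := a) (V := V) hu.2.2
    rw [hS u hu, ← mul_assoc, ← mul_assoc, ← ENNReal.ofReal_mul (abs_nonneg _),
      ← ENNReal.ofReal_mul (massWeight_pos hu.1).le, mul_div_cancel₀ _
      (abs_det_pointJacobian_pos hu).ne', mul_comm (ensembleWeight _ _ _ _ _)]

/-- A measurable function which computes the points of a measure from its moments. -/
theorem exists_measurable_leftInverse_pointMap (n : ℕ) [NeZero n] :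
    ∃ S : (Fin (n * 2) → ℝ) → (Fin (n * 2) → ℝ), Measurable S ∧
      ∀ u ∈ pointDomain n, S (pointMap u) = u := by
  -- A continuous injection on a Borel set is a measurable embedding (Lusin–Souslin), so its inverse
  -- extends measurably.
  have hcont : Continuous (pointMap (n := n)) := continuous_iff_continuousAt.2 fun u =>
    (hasFDerivAt_pointMap u).continuousAt
  obtain ⟨S, hS, hSu⟩ := (hcont.continuousOn.measurableEmbedding measurableSet_pointDomain
    injOn_pointMap).exists_measurable_extend measurable_subtype_coe fun _ => ⟨0⟩
  exact ⟨S, hS, fun u hu => congrFun hSu ⟨u, hu⟩⟩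

/-- On positive entries the eigenvalues are a measurable function of the moments of the path with
mass one, which are polynomials in the entries. -/
theorem aemeasurable_orderedEigenvalues :
    AEMeasurable (fun p : (Fin n → ℝ) × (Fin (n - 1) → ℝ) => orderedEigenvalues p.1 p.2)
      (volume.restrict (modelDomain n)) := by
  obtain ⟨S, hS, hSu⟩ := exists_measurable_leftInverse_pointMap n
  refine ⟨fun p => pointPart (S (pathMap ((weightsEquiv n).symm (p, 1)))),
    measurable_pointPart.comp (hS.comp (differentiable_pathMap.continuous.measurable.comp
      ((weightsEquiv n).symm.measurable.comp (measurable_id.prodMk measurable_const)))), ?_⟩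
  refine (ae_restrict_iff' measurableSet_modelDomain).2 (.of_forall fun p hp => ?_)
  obtain ⟨v, hv, hl, hm⟩ := exists_pointDomain_pointMap_eq hp.1 hp.2 one_pos
  have : (weightsEquiv n).symm (p, 1) = pathWeights p.1 p.2 1 := by
    rw [MeasurableEquiv.symm_apply_eq, weightsEquiv_pathWeights]
  simp only
  rw [this, ← hm, hSu v hv, hl]

theorem measurable_modelWeight (n : ℕ) (β a : ℝ) (V : ℝ[X]) :
    Measurable (modelWeight n β a V) := by
  have hB : Continuous fun p : (Fin n → ℝ) × (Fin (n - 1) → ℝ) => bidiagonal p.1 p.2 := by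
    refine continuous_matrix fun i j => ?_
    unfold bidiagonal
    split_ifs <;> fun_prop
  have hT : Continuous fun p : (Fin n → ℝ) × (Fin (n - 1) → ℝ) => tridiagonal p.1 p.2 :=
    hB.matrix_mul hB.matrix_transpose
  have hV : Continuous fun p : (Fin n → ℝ) × (Fin (n - 1) → ℝ) =>
      (aeval (tridiagonal p.1 p.2) V).trace := by
    simp only [aeval_eq_sum_range]
    exact (continuous_finsetSum _ fun k _ => (hT.pow k).const_smul (V.coeff k)).matrix_trace
  refine Measurable.mul (Measurable.mul ?_ ?_) ?_
  · exact (Real.measurable_exp.comp (measurable_const.mul hV.measurable).neg)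
  · exact Finset.measurable_prod _ fun k _ =>
      ((measurable_pi_apply k).comp measurable_fst).pow_const _
  · exact Finset.measurable_prod _ fun k _ =>
      ((measurable_pi_apply k).comp measurable_snd).pow_const _

theorem measurable_ensembleWeight (n : ℕ) (β a : ℝ) (V : ℝ[X]) :
    Measurable (ensembleWeight n β a V) := by
  refine Measurable.mul ?_ ?_
  · exact Finset.measurable_prod _ fun i _ => Finset.measurable_prod _ fun j _ =>
      ((measurable_pi_apply i).sub (measurable_pi_apply j)).abs.pow_const _
  · exact Finset.measurable_prod _ fun i _ => ((measurable_pi_apply i).pow_const _).mul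
      (Real.measurable_exp.comp (measurable_const.mul
        (V.continuous.measurable.comp (measurable_pi_apply i))).neg)

theorem measurable_massWeight (n : ℕ) (β : ℝ) : Measurable (massWeight n β) :=
  Finset.measurable_prod _ fun i _ => ((measurable_pi_apply i).pow_const _).mul
    (Real.measurable_exp.comp (measurable_pi_apply i).neg)

/-- The change of variables from bidiagonal matrices to spectra, up to constants. -/
theorem lintegral_modelWeight_mul {β a : ℝ} {V : ℝ[X]} {g : (Fin n → ℝ) → ℝ≥0∞}
    (hg : Measurable g) :
    (∫⁻ w in {w : Fin n → ℝ | ∀ i, 0 < w i}, ENNReal.ofReal (massWeight n β w)) *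
        ∫⁻ l in {l | StrictMono l ∧ ∀ i, 0 < l i},
          ENNReal.ofReal (ensembleWeight n β a V l) * g l =
      2 ^ (n * 2 - 1) * ((∫⁻ p in modelDomain n, ENNReal.ofReal (modelWeight n β a V p) *
          g (orderedEigenvalues p.1 p.2)) *
        ∫⁻ c in Set.Ioi (0 : ℝ), ENNReal.ofReal (c ^ (n * β / 2 - 1) * Real.exp (-c))) := by
  have h1 : pointDomain n = splitEquiv (halvesEquiv n) ⁻¹'
      ({w : Fin n → ℝ | ∀ i, 0 < w i} ×ˢ {l | StrictMono l ∧ ∀ i, 0 < l i}) := rfl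
  have h2 : {u : Fin (n * 2) → ℝ | ∀ k, 0 < u k} = weightsEquiv n ⁻¹'
      (modelDomain n ×ˢ Set.Ioi (0 : ℝ)) := by
    ext u
    obtain ⟨⟨⟨x, y⟩, c⟩, rfl⟩ := (weightsEquiv n).symm.surjective u
    have : (weightsEquiv n).symm ((x, y), c) = pathWeights x y c := by
      rw [MeasurableEquiv.symm_apply_eq, weightsEquiv_pathWeights]
    rw [this, Set.mem_preimage, weightsEquiv_pathWeights]
    exact pathWeights_pos_iff
  have key := lintegral_pointDomain_eq_lintegral_pos (β := β) (a := a) (V := V) g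
  rw [h1, h2, measurePreserving_weightsEquiv.setLIntegral_comp_preimage_emb
    (weightsEquiv n).measurableEmbedding (fun q => 2 ^ (n * 2 - 1) *
        ((ENNReal.ofReal (modelWeight n β a V q.1) * g (orderedEigenvalues q.1.1 q.1.2)) *
        ENNReal.ofReal (q.2 ^ (n * β / 2 - 1) * Real.exp (-q.2)))),
    Measure.volume_eq_prod, ← Measure.prod_restrict, lintegral_const_mul'] at key
  · have key2 := (measurePreserving_splitEquiv (halvesEquiv n)).setLIntegral_comp_preimage_emb
      (splitEquiv (halvesEquiv n)).measurableEmbedding (fun q : (Fin n → ℝ) × (Fin n → ℝ) =>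
        ENNReal.ofReal (massWeight n β q.1) *
          (ENNReal.ofReal (ensembleWeight n β a V q.2) * g q.2))
      ({w : Fin n → ℝ | ∀ i, 0 < w i} ×ˢ {l | StrictMono l ∧ ∀ i, 0 < l i})
    rw [Measure.volume_eq_prod, ← Measure.prod_restrict, lintegral_prod_mul
      (f := fun w => ENNReal.ofReal (massWeight n β w))
      (g := fun l => ENNReal.ofReal (ensembleWeight n β a V l) * g l)] at key2
    · rw [← key2]
      refine key.trans ?_
      congr 1
      refine lintegral_prod_mul
        (f := fun p : (Fin n → ℝ) × (Fin (n - 1) → ℝ) =>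
          ENNReal.ofReal (modelWeight n β a V p) * g (orderedEigenvalues p.1 p.2))
        (g := fun c : ℝ => ENNReal.ofReal (c ^ (n * β / 2 - 1) * Real.exp (-c))) ?_ ?_
      · exact (measurable_modelWeight n β a V).ennreal_ofReal.aemeasurable.mul
          (hg.comp_aemeasurable aemeasurable_orderedEigenvalues)
      · exact ((measurable_id.pow_const _).mul
          (Real.measurable_exp.comp measurable_neg)).ennreal_ofReal.aemeasurable
    · exact (measurable_massWeight n β).ennreal_ofReal.aemeasurable
    · exact ((measurable_ensembleWeight n β a V).ennreal_ofReal.mul hg).aemeasurable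
  · finiteness

end Transfer

/-! ### Finite positive integrals. -/

section Finiteness

theorem setLIntegral_ofReal_ne_zero {E : Type*} [MeasurableSpace E] {μ : Measure E} {s : Set E}
    (hμ : μ s ≠ 0) {f : E → ℝ} (hf : Measurable f) (hpos : ∀ x ∈ s, 0 < f x) :
    ∫⁻ x in s, ENNReal.ofReal (f x) ∂μ ≠ 0 := by
  refine ((setLIntegral_pos_iff hf.ennreal_ofReal).2 ?_).ne'
  refine lt_of_lt_of_le (pos_iff_ne_zero.2 hμ) (measure_mono fun x hx => ⟨?_, hx⟩)
  simpa using hpos x hx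

theorem lintegral_rpow_mul_exp_ne_zero (s δ p : ℝ) :
    ∫⁻ t in Set.Ioi (0 : ℝ), ENNReal.ofReal (t ^ (s - 1) * Real.exp (-δ * t ^ p)) ≠ 0 :=
  setLIntegral_ofReal_ne_zero (by simp)
    ((measurable_id.pow_const _).mul (Real.measurable_exp.comp
      (measurable_const.mul (measurable_id.pow_const _))))
    fun _ ht => mul_pos (Real.rpow_pos_of_pos ht _) (Real.exp_pos _)

theorem lintegral_rpow_mul_exp_ne_top {s δ p : ℝ} (hs : 0 < s) (hδ : 0 < δ) (hp : 0 < p) :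
    ∫⁻ t in Set.Ioi (0 : ℝ), ENNReal.ofReal (t ^ (s - 1) * Real.exp (-δ * t ^ p)) ≠ ⊤ :=
  (Integrable.lintegral_lt_top (integrableOn_rpow_mul_exp_neg_mul_rpow (by linarith) hp hδ)).ne

/-- A polynomial tending to infinity is not constant, so it dominates a multiple of `t` near
infinity. Compactness covers the rest of the half-line. -/
theorem exists_linear_le_eval {V : ℝ[X]}
    (hV : Filter.Tendsto (fun t : ℝ => V.eval t) Filter.atTop Filter.atTop) :
    ∃ c > 0, ∃ K, ∀ t ≥ 0, c * t - K ≤ V.eval t := by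
  have hdeg : (Polynomial.X : ℝ[X]).degree ≤ V.degree := by
    rw [degree_X]
    by_contra h
    rw [not_le] at h
    rw [eq_C_of_degree_le_zero (Order.lt_succ_iff.1 h)] at hV
    simp only [eval_C] at hV
    exact Filter.not_tendsto_const_atTop _ _ hV
  obtain ⟨C, hC, hO⟩ := (isBigO_atTop_of_degree_le _ _ hdeg).exists_pos
  obtain ⟨T, hT⟩ := Filter.eventually_atTop.1 (hO.bound.and (hV.eventually_ge_atTop 0))
  obtain ⟨M, hM⟩ := (isCompact_Icc (a := (0 : ℝ)) (b := T)).exists_bound_of_continuousOn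
    (f := fun t => C⁻¹ * t - V.eval t) (by fun_prop)
  refine ⟨C⁻¹, inv_pos.2 hC, max M 0, fun t ht => ?_⟩
  rcases le_total t T with h | h
  · have := le_abs_self (C⁻¹ * t - V.eval t) |>.trans (hM t ⟨ht, h⟩)
    have := le_max_left M 0
    linarith
  · obtain ⟨h1, h2⟩ := hT t h
    rw [eval_X, Real.norm_of_nonneg ht, Real.norm_of_nonneg h2] at h1
    have h3 : C⁻¹ * t ≤ V.eval t := by
      rw [inv_mul_le_iff₀ hC]
      exact h1
    have := le_max_right M 0
    linarith

theorem exists_one_add_rpow_le {r δ : ℝ} (hr : 0 ≤ r) (hδ : 0 < δ) :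
    ∃ K : ℝ, ∀ t ≥ 0, (1 + t) ^ r ≤ K * Real.exp (δ * t) := by
  -- `ε ≤ 1` gives ε (1 + t) ≤ 1 + ε t ≤ exp(ε t), and the other bound gives ε r ≤ δ after raising
  -- to the power `r`.
  set ε := min 1 (δ / (r + 1))
  have hε : 0 < ε := lt_min one_pos (by positivity)
  refine ⟨(ε⁻¹) ^ r, fun t ht => ?_⟩
  have h1 : 1 + t ≤ ε⁻¹ * Real.exp (ε * t) := by
    rw [le_inv_mul_iff₀ hε]
    have h2 := Real.add_one_le_exp (ε * t)
    have h3 : ε ≤ 1 := min_le_left _ _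
    linarith
  have h4 : ε * r ≤ δ := by
    have h5 : ε ≤ δ / (r + 1) := min_le_right _ _
    rw [le_div_iff₀ (by positivity)] at h5
    nlinarith
  calc (1 + t) ^ r ≤ (ε⁻¹ * Real.exp (ε * t)) ^ r :=
        Real.rpow_le_rpow (by positivity) h1 hr
    _ = ε⁻¹ ^ r * Real.exp (ε * r * t) := by
        rw [Real.mul_rpow (by positivity) (Real.exp_pos _).le, ← Real.exp_mul]
        congr 2
        ring
    _ ≤ _ := by gcongr

theorem lintegral_one_add_rpow_mul_exp_ne_top {V : ℝ[X]}
    (hV : Filter.Tendsto (fun t : ℝ => V.eval t) Filter.atTop Filter.atTop) {s r κ : ℝ}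
    (hs : 0 < s) (hr : 0 ≤ r) (hκ : 0 < κ) :
    ∫⁻ t in Set.Ioi (0 : ℝ),
      ENNReal.ofReal ((1 + t) ^ r * (t ^ (s - 1) * Real.exp (-(κ * V.eval t)))) ≠ ⊤ := by
  obtain ⟨c, hc, K, hK⟩ := exists_linear_le_eval hV
  -- Half of the exponential decay absorbs the power of `1 + t`; the other half keeps the integral
  -- finite.
  have hδ : 0 < κ * c / 2 := by positivity
  obtain ⟨M, hM⟩ := exists_one_add_rpow_le hr hδ
  have hM0 : 0 ≤ M := by
    have h1 := hM 0 le_rfl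
    simp only [add_zero, Real.one_rpow, mul_zero, Real.exp_zero, mul_one] at h1
    linarith
  have hle : ∀ t ∈ Set.Ioi (0 : ℝ),
      ENNReal.ofReal ((1 + t) ^ r * (t ^ (s - 1) * Real.exp (-(κ * V.eval t)))) ≤
      ENNReal.ofReal (M * Real.exp (κ * K)) *
        ENNReal.ofReal (t ^ (s - 1) * Real.exp (-(κ * c / 2) * t ^ (1 : ℝ))) := by
    intro t ht
    have ht : 0 < t := ht
    rw [← ENNReal.ofReal_mul (by positivity)]
    refine ENNReal.ofReal_le_ofReal ?_
    have h1 : Real.exp (-(κ * V.eval t)) ≤ Real.exp (κ * K) * Real.exp (-(κ * c * t)) := by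
      rw [← Real.exp_add, Real.exp_le_exp]
      have := mul_le_mul_of_nonneg_left (hK t ht.le) hκ.le
      linarith
    calc (1 + t) ^ r * (t ^ (s - 1) * Real.exp (-(κ * V.eval t)))
        ≤ (M * Real.exp (κ * c / 2 * t)) *
          (t ^ (s - 1) * (Real.exp (κ * K) * Real.exp (-(κ * c * t)))) := by
          gcongr
          exact hM t ht.le
      _ = M * Real.exp (κ * K) * (t ^ (s - 1) * (Real.exp (κ * c / 2 * t) *
            Real.exp (-(κ * c * t)))) := by ring
      _ = _ := by
          rw [← Real.exp_add, Real.rpow_one]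
          congr 3
          ring
  refine ((setLIntegral_mono_ae' measurableSet_Ioi (.of_forall hle)).trans_lt ?_).ne
  rw [lintegral_const_mul' _ _ ENNReal.ofReal_ne_top]
  exact ENNReal.mul_lt_top ENNReal.ofReal_lt_top
    (lintegral_rpow_mul_exp_ne_top hs hδ one_pos).lt_top

variable {n : ℕ}

theorem setLIntegral_prod_eq_prod {f : Fin n → ℝ → ℝ} (hf : ∀ i, Measurable (f i))
    (hf0 : ∀ i, ∀ t > 0, 0 ≤ f i t) :
    ∫⁻ w in {w : Fin n → ℝ | ∀ i, 0 < w i}, ENNReal.ofReal (∏ i, f i (w i)) =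
      ∏ i, ∫⁻ t in Set.Ioi (0 : ℝ), ENNReal.ofReal (f i t) := by
  rw [← lintegral_fin_prod_eq_prod _ fun i => (hf i).ennreal_ofReal, ← restrict_forall_pos]
  refine setLIntegral_congr_fun (measurableSet_forall_pos _) fun w hw => ?_
  exact ENNReal.ofReal_prod_of_nonneg fun i _ => hf0 i _ (hw i)

theorem lintegral_massWeight_ne {β : ℝ} (hβ : 0 < β) :
    ∫⁻ w in {w : Fin n → ℝ | ∀ i, 0 < w i}, ENNReal.ofReal (massWeight n β w) ≠ 0 ∧
    ∫⁻ w in {w : Fin n → ℝ | ∀ i, 0 < w i}, ENNReal.ofReal (massWeight n β w) ≠ ⊤ := by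
  unfold massWeight
  rw [setLIntegral_prod_eq_prod (f := fun _ t => t ^ (β / 2 - 1) * Real.exp (-t))
    (fun i => (measurable_id.pow_const _).mul (Real.measurable_exp.comp measurable_neg))
    fun i t ht => mul_nonneg (Real.rpow_nonneg ht.le _) (Real.exp_nonneg _)]
  have h1 := lintegral_rpow_mul_exp_ne_zero (β / 2) 1 1
  have h2 := lintegral_rpow_mul_exp_ne_top (half_pos hβ) one_pos one_pos
  simp only [Real.rpow_one, neg_mul, one_mul] at h1 h2
  exact ⟨Finset.prod_ne_zero_iff.2 fun i _ => h1, ENNReal.prod_ne_top fun i _ => h2⟩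

/-- Every difference satisfies |l_i - l_j| ≤ (1 + l_i)(1 + l_j) ≤ ∏(1 + l_k), and there are at most
n² of them. This crude bound is a product of functions of one variable. -/
theorem ensembleWeight_le {β a : ℝ} (hβ : 0 < β) {V : ℝ[X]} {l : Fin n → ℝ} (hl : ∀ i, 0 < l i) :
    ensembleWeight n β a V l ≤ ∏ i, ((1 + l i) ^ (β * (n * n)) *
      (l i ^ (β / 2 * (a + 1) - 1) * Real.exp (-(β * n * V.eval (l i))))) := by
  rw [ensembleWeight, Finset.prod_mul_distrib (f := fun i => (1 + l i) ^ (β * (n * n)))]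
  refine mul_le_mul_of_nonneg_right ?_ (Finset.prod_nonneg fun i _ =>
    mul_nonneg (Real.rpow_nonneg (hl i).le _) (Real.exp_nonneg _))
  rw [Real.finsetProd_rpow _ _ fun i _ => (by have := hl i; positivity)]
  set S := ∏ i, (1 + l i)
  have hS : ∀ s : Finset (Fin n), 1 ≤ ∏ i ∈ s, (1 + l i) := fun s =>
    Finset.prod_induction _ (fun t => 1 ≤ t) (fun _ _ => one_le_mul_of_one_le_of_one_le) le_rfl
      fun i _ => by have := hl i; linarith
  have hS1 : 1 ≤ S := hS _
  have hpair : ∀ i, ∀ j ∈ Finset.Ioi i, |l i - l j| ^ β ≤ S ^ β := fun i j hj => by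
    refine Real.rpow_le_rpow (abs_nonneg _) ?_ hβ.le
    have hij : j ≠ i := (Finset.mem_Ioi.1 hj).ne'
    have hSij : S = (1 + l i) * ((1 + l j) * ∏ k ∈ (Finset.univ.erase i).erase j, (1 + l k)) := by
      rw [Finset.mul_prod_erase _ (fun k => 1 + l k) (Finset.mem_erase.2 ⟨hij, Finset.mem_univ j⟩),
        Finset.mul_prod_erase _ (fun k => 1 + l k) (Finset.mem_univ i)]
    have hi := hl i
    have hj := hl j
    have h1 : (1 + l i) * (1 + l j) ≤ S := by
      rw [hSij, ← mul_assoc]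
      exact le_mul_of_one_le_right (by positivity) (hS _)
    refine le_trans (abs_le.2 ⟨?_, ?_⟩) h1 <;> nlinarith
  have hS2 : 1 ≤ S ^ β := Real.one_le_rpow hS1 hβ.le
  calc ∏ i : Fin n, ∏ j ∈ Finset.Ioi i, |l i - l j| ^ β
      ≤ ∏ i : Fin n, ∏ j ∈ Finset.Ioi i, S ^ β := by
        refine Finset.prod_le_prod (fun i _ => Finset.prod_nonneg fun j _ =>
          Real.rpow_nonneg (abs_nonneg _) _) fun i _ => Finset.prod_le_prod (fun j _ =>
          Real.rpow_nonneg (abs_nonneg _) _) fun j hj => hpair i j hj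
    _ ≤ ∏ _i : Fin n, (S ^ β) ^ n := by
        refine Finset.prod_le_prod (fun i _ => Finset.prod_nonneg fun j _ => by positivity)
          fun i _ => ?_
        rw [Finset.prod_const]
        refine pow_le_pow_right₀ hS2 ?_
        exact (Finset.card_le_univ _).trans (by simp)
    _ = S ^ (β * (n * n)) := by
        rw [Finset.prod_const, Finset.card_univ, Fintype.card_fin, ← pow_mul, ← Real.rpow_natCast,
          ← Real.rpow_mul (by linarith)]
        push_cast
        rfl

theorem lintegral_ensembleWeight_ne_top {β a : ℝ} (hn : 1 ≤ n) (hβ : 0 < β) (ha : -1 < a) {V : ℝ[X]}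
    (hV : Filter.Tendsto (fun t : ℝ => V.eval t) Filter.atTop Filter.atTop) :
    ∫⁻ l in {l : Fin n → ℝ | ∀ i, 0 < l i}, ENNReal.ofReal (ensembleWeight n β a V l) ≠ ⊤ := by
  have hn0 : (0 : ℝ) < n := by exact_mod_cast hn
  refine ((setLIntegral_mono_ae' (measurableSet_forall_pos _) (.of_forall fun l hl =>
    ENNReal.ofReal_le_ofReal (ensembleWeight_le hβ hl))).trans_lt ?_).ne
  rw [setLIntegral_prod_eq_prod (f := fun _ t => (1 + t) ^ (β * (n * n)) *
      (t ^ (β / 2 * (a + 1) - 1) * Real.exp (-(β * n * V.eval t))))]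
  · refine ENNReal.prod_lt_top fun i _ => (lintegral_one_add_rpow_mul_exp_ne_top hV ?_ ?_ ?_).lt_top
    · exact mul_pos (half_pos hβ) (by linarith)
    · positivity
    · positivity
  · exact fun i => ((measurable_const.add measurable_id).pow_const _).mul
      ((measurable_id.pow_const _).mul (Real.measurable_exp.comp
        (measurable_const.mul V.continuous.measurable).neg))
  · exact fun i t ht => by positivity

theorem lintegral_ensembleWeight_strictMono_ne_zero {β a : ℝ} {V : ℝ[X]} :
    ∫⁻ l in {l : Fin n → ℝ | StrictMono l ∧ ∀ i, 0 < l i},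
      ENNReal.ofReal (ensembleWeight n β a V l) ≠ 0 := by
  refine setLIntegral_ofReal_ne_zero ?_
    (measurable_ensembleWeight n β a V) fun l hl => ?_
  · have hopen : IsOpen {l : Fin n → ℝ | StrictMono l ∧ ∀ i, 0 < l i} := by
      have : {l : Fin n → ℝ | StrictMono l ∧ ∀ i, 0 < l i} =
          (⋂ i, ⋂ j, ⋂ _ : i < j, {l | l i < l j}) ∩ ⋂ i, {l | 0 < l i} := by
        ext l
        simp [StrictMono]
      rw [this]
      exact (isOpen_iInter_of_finite fun i => isOpen_iInter_of_finite fun j =>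
        isOpen_iInter_of_finite fun _ => isOpen_lt (continuous_apply i) (continuous_apply j)).inter
        (isOpen_iInter_of_finite fun i => isOpen_lt continuous_const (continuous_apply i))
    refine (hopen.measure_pos volume ⟨fun i => (i : ℝ) + 1, fun i j hij => ?_, fun i => ?_⟩).ne'
    · simpa using hij
    · positivity
  · refine mul_pos (Finset.prod_pos fun i _ => Finset.prod_pos fun j hj => ?_)
      (Finset.prod_pos fun i _ => mul_pos (Real.rpow_pos_of_pos (hl.2 i) _) (Real.exp_pos _))
    exact Real.rpow_pos_of_pos (abs_pos.2 (sub_ne_zero.2 (hl.1 (Finset.mem_Ioi.1 hj)).ne)) _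

end Finiteness

/-! ### Normalization commutes with pushforwards and products. -/

section NormalizedMeasure

variable {E F : Type*} [MeasurableSpace E] [MeasurableSpace F] {μ : Measure E}

theorem isProbabilityMeasure_normalizedMeasure (h0 : μ Set.univ ≠ 0) (ht : μ Set.univ ≠ ⊤) :
    IsProbabilityMeasure (normalizedMeasure μ) :=
  ⟨by rw [normalizedMeasure, Measure.smul_apply, smul_eq_mul, ENNReal.inv_mul_cancel h0 ht]⟩

theorem normalizedMeasure_smul {c : ℝ≥0∞} (h0 : c ≠ 0) (ht : c ≠ ⊤) :
    normalizedMeasure (c • μ) = normalizedMeasure μ := by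
  rw [normalizedMeasure, normalizedMeasure, Measure.smul_apply, smul_eq_mul,
    ENNReal.mul_inv (Or.inl h0) (Or.inl ht), smul_smul, mul_right_comm,
    ENNReal.inv_mul_cancel h0 ht, one_mul]

theorem map_normalizedMeasure {f : E → F} (hf : AEMeasurable f μ) :
    (normalizedMeasure μ).map f = normalizedMeasure (μ.map f) := by
  rw [normalizedMeasure, normalizedMeasure, Measure.map_smul, Measure.map_apply_of_aemeasurable hf
    .univ, Set.preimage_univ]

theorem normalizedMeasure_prod {ν : Measure F} [SFinite μ] [SFinite ν] (hμ0 : μ Set.univ ≠ 0)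
    (hμ : μ Set.univ ≠ ⊤) :
    (normalizedMeasure μ).prod (normalizedMeasure ν) = normalizedMeasure (μ.prod ν) := by
  rw [normalizedMeasure, normalizedMeasure, normalizedMeasure, Measure.prod_smul_left,
    Measure.prod_smul_right, smul_smul, ← Set.univ_prod_univ, Measure.prod_prod,
    ENNReal.mul_inv (Or.inl hμ0) (Or.inl hμ)]

theorem normalizedMeasure_pi {n : ℕ} {μ : Fin n → Measure ℝ} [∀ i, SigmaFinite (μ i)]
    (h0 : ∀ i, μ i Set.univ ≠ 0) (ht : ∀ i, μ i Set.univ ≠ ⊤) :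
    Measure.pi (fun i => normalizedMeasure (μ i)) = normalizedMeasure (Measure.pi μ) := by
  have := fun i => isProbabilityMeasure_normalizedMeasure (h0 i) (ht i)
  refine Measure.pi_eq fun s _ => ?_
  rw [normalizedMeasure, Measure.smul_apply, Measure.pi_pi, Measure.pi_univ, smul_eq_mul,
    ENNReal.prod_inv_distrib fun i _ j _ _ => Or.inl (h0 i), ← Finset.prod_mul_distrib]
  rfl

end NormalizedMeasure

/-! ### From ordered to exchangeable vectors. -/

section Permutations

variable {n : ℕ}

theorem measurable_comp_perm (σ : Equiv.Perm (Fin n)) :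
    Measurable fun l : Fin n → ℝ => l ∘ σ :=
  measurable_pi_lambda _ fun i => measurable_pi_apply (σ i)

/-- An exchangeable measure without ties is recovered by randomly permuting ordered vectors. -/
theorem sum_map_comp_perm_restrict {ν : Measure (Fin n → ℝ)}
    (hν : ∀ σ : Equiv.Perm (Fin n), ν.map (fun l => l ∘ σ) = ν)
    (hinj : ν {l | ¬ Function.Injective l} = 0) :
    ∑ σ : Equiv.Perm (Fin n), (ν.restrict {l | StrictMono l}).map (fun l => l ∘ σ) = ν := by
  -- The chambers of vectors sorted by a given permutation: they are disjoint and cover all vectors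
  -- without ties.
  set T : Equiv.Perm (Fin n) → Set (Fin n → ℝ) := fun σ => {l | StrictMono (l ∘ σ.symm)}
  have hT : ∀ σ, MeasurableSet (T σ) := fun σ =>
    measurable_comp_perm σ.symm (measurableSet_strictMono n)
  have h1 : ∀ σ : Equiv.Perm (Fin n),
      (ν.restrict {l | StrictMono l}).map (fun l => l ∘ σ) = ν.restrict (T σ) := fun σ => by
    have h2 : {l : Fin n → ℝ | StrictMono l} = (fun l => l ∘ σ) ⁻¹' T σ := by
      ext l
      simp [T, Function.comp_assoc]
    rw [h2, ← Measure.restrict_map (measurable_comp_perm σ) (hT σ), hν]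
  simp only [h1]
  rw [← Measure.sum_fintype, ← Measure.restrict_iUnion _ hT]
  · refine Measure.restrict_eq_self_of_ae_mem ?_
    have : ∀ᵐ l ∂ν, Function.Injective l := hinj
    filter_upwards [this] with l hl
    refine Set.mem_iUnion.2 ⟨(Tuple.sort l).symm, ?_⟩
    exact (Tuple.monotone_sort l).strictMono_of_injective (hl.comp (Tuple.sort l).injective)
  · intro σ τ hστ
    refine Set.disjoint_left.2 fun l (hσ : StrictMono _) (hτ : StrictMono _) => hστ ?_
    have h3 : l ∘ σ.symm = l ∘ τ.symm := (hσ.range_inj hτ).1 (by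
      rw [Set.range_comp, Set.range_comp, σ.symm.surjective.range_eq, τ.symm.surjective.range_eq])
    have hl : Function.Injective l := by
      have := hσ.injective.comp σ.injective
      rwa [Function.comp_assoc, Equiv.symm_comp_self, Function.comp_id] at this
    have h4 : σ.symm = τ.symm := Equiv.ext fun i => hl (congrFun h3 i)
    exact Equiv.symm_bijective.injective h4

theorem ensembleWeight_comp_perm {β a : ℝ} {V : ℝ[X]} (l : Fin n → ℝ) (σ : Equiv.Perm (Fin n)) :
    ensembleWeight n β a V (l ∘ σ) = ensembleWeight n β a V l := by
  unfold ensembleWeight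
  rw [prod_prod_abs_sub_rpow, prod_prod_abs_sub_rpow]
  congr 1
  · have h1 : Matrix.vandermonde (l ∘ σ) = (Matrix.vandermonde l).submatrix σ id := rfl
    rw [h1, Matrix.det_permute, abs_mul]
    rcases Int.units_eq_one_or (Equiv.Perm.sign σ) with h | h <;> simp [h]
  · exact Equiv.prod_comp σ fun i =>
      l i ^ (β / 2 * (a + 1) - 1) * Real.exp (-(β * n * V.eval (l i)))

/-- The unnormalized `β`-ensemble. -/
noncomputable def ensembleMeasure (n : ℕ) (β a : ℝ) (V : ℝ[X]) : Measure (Fin n → ℝ) :=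
  (volume.restrict {l | ∀ i, 0 < l i}).withDensity
    fun l => ENNReal.ofReal (ensembleWeight n β a V l)

theorem map_comp_perm_ensembleMeasure {β a : ℝ} {V : ℝ[X]} (σ : Equiv.Perm (Fin n)) :
    (ensembleMeasure n β a V).map (fun l => l ∘ σ) = ensembleMeasure n β a V := by
  have hpos := measurableSet_forall_pos (Fin n)
  ext s hs
  rw [Measure.map_apply (measurable_comp_perm σ) hs, ensembleMeasure,
    withDensity_apply _ (measurable_comp_perm σ hs), withDensity_apply _ hs,
    Measure.restrict_restrict (measurable_comp_perm σ hs), Measure.restrict_restrict hs]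
  have h1 : (fun l : Fin n → ℝ => l ∘ σ) ⁻¹' s ∩ {l | ∀ i, 0 < l i} =
      (MeasurableEquiv.piCongrLeft (fun _ => ℝ) σ).symm ⁻¹' (s ∩ {l | ∀ i, 0 < l i}) := by
    ext l
    refine and_congr Iff.rfl ?_
    exact (σ.forall_congr_right (q := fun i => 0 < l i)).symm
  have h2 := ((volume_measurePreserving_piCongrLeft (fun _ => ℝ)
    σ).symm).setLIntegral_comp_preimage_emb
    (MeasurableEquiv.piCongrLeft (fun _ => ℝ) σ).symm.measurableEmbedding
    (fun l => ENNReal.ofReal (ensembleWeight n β a V l)) (s ∩ {l | ∀ i, 0 < l i})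
  rw [h1, ← h2]
  refine lintegral_congr fun l => ?_
  rw [← ensembleWeight_comp_perm l σ]
  rfl

/-- The density itself vanishes at ties, because β > 0. -/
theorem ensembleMeasure_not_injective {β a : ℝ} (hβ : 0 < β) {V : ℝ[X]} :
    ensembleMeasure n β a V {l | ¬ Function.Injective l} = 0 := by
  have hs : MeasurableSet {l : Fin n → ℝ | ¬ Function.Injective l} := by
    have : {l : Fin n → ℝ | ¬ Function.Injective l} = ⋃ i, ⋃ j, ⋃ _ : i ≠ j, {l | l i = l j} := by
      ext l
      simp [Function.Injective, and_comm]
    rw [this]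
    exact .iUnion fun i => .iUnion fun j => .iUnion fun _ =>
      measurableSet_eq_fun (measurable_pi_apply i) (measurable_pi_apply j)
  rw [ensembleMeasure, withDensity_apply _ hs, setLIntegral_congr_fun hs (g := fun _ => 0),
    lintegral_zero]
  intro l (hl : ¬ Function.Injective l)
  simp only
  rw [ensembleWeight, prod_prod_abs_sub_rpow,
    not_not.1 (mt Matrix.det_vandermonde_ne_zero_iff.1 hl), abs_zero, Real.zero_rpow hβ.ne',
    zero_mul, ENNReal.ofReal_zero]

end Permutations

/-! ### The law of the ordered eigenvalues. -/

section Pushforward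

variable {n : ℕ} {β a : ℝ} {V : ℝ[X]}

/-- The unnormalized law of the bidiagonal matrix. -/
noncomputable def modelMeasure (n : ℕ) (β a : ℝ) (V : ℝ[X]) :
    Measure ((Fin n → ℝ) × (Fin (n - 1) → ℝ)) :=
  (volume.restrict (modelDomain n)).withDensity fun p => ENNReal.ofReal (modelWeight n β a V p)

theorem modelLaw_eq : modelLaw n β a V = normalizedMeasure (modelMeasure n β a V) := rfl

theorem betaEnsemble_eq : betaEnsemble n β a V = normalizedMeasure (ensembleMeasure n β a V) := rfl

theorem aemeasurable_orderedEigenvalues_modelMeasure [NeZero n] :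
    AEMeasurable (fun p : (Fin n → ℝ) × (Fin (n - 1) → ℝ) => orderedEigenvalues p.1 p.2)
      (modelMeasure n β a V) :=
  aemeasurable_orderedEigenvalues.mono_ac (withDensity_absolutelyContinuous _ _)

theorem restrict_ensembleMeasure_apply {s : Set (Fin n → ℝ)} (hs : MeasurableSet s) :
    (ensembleMeasure n β a V).restrict {l | StrictMono l} s =
      ∫⁻ l in {l | StrictMono l ∧ ∀ i, 0 < l i},
        ENNReal.ofReal (ensembleWeight n β a V l) * s.indicator 1 l := by
  have hSM := measurableSet_strictMono n
  have hind : ∀ l, ENNReal.ofReal (ensembleWeight n β a V l) * s.indicator 1 l =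
      s.indicator (fun l => ENNReal.ofReal (ensembleWeight n β a V l)) l := fun l => by
    by_cases h : l ∈ s <;> simp [h]
  simp only [hind]
  rw [lintegral_indicator hs, Measure.restrict_apply hs, ensembleMeasure,
    withDensity_apply _ (hs.inter hSM), Measure.restrict_restrict (hs.inter hSM),
    Measure.restrict_restrict hs, Set.inter_assoc]
  rfl

/-- The ordered eigenvalues push the unnormalized model forward to a multiple of the unnormalized
ensemble on increasing vectors. -/
theorem exists_map_modelMeasure_eq [NeZero n] (hβ : 0 < β) :
    ∃ C : ℝ≥0∞, C ≠ 0 ∧ C ≠ ⊤ ∧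
      (modelMeasure n β a V).map (fun p => orderedEigenvalues p.1 p.2) =
        C • (ensembleMeasure n β a V).restrict {l | StrictMono l} := by
  obtain ⟨hw0, hwt⟩ := lintegral_massWeight_ne (n := n) hβ
  have hn0 : (0 : ℝ) < n := by exact_mod_cast NeZero.pos n
  have hc0 := lintegral_rpow_mul_exp_ne_zero (n * β / 2) 1 1
  have hct := lintegral_rpow_mul_exp_ne_top (s := n * β / 2) (by positivity) one_pos one_pos
  simp only [Real.rpow_one, neg_mul, one_mul] at hc0 hct
  set W := ∫⁻ w in {w : Fin n → ℝ | ∀ i, 0 < w i}, ENNReal.ofReal (massWeight n β w)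
  set G := ∫⁻ c in Set.Ioi (0 : ℝ), ENNReal.ofReal (c ^ (n * β / 2 - 1) * Real.exp (-c))
  set D : ℝ≥0∞ := 2 ^ (n * 2 - 1) * G
  have hD0 : D ≠ 0 := mul_ne_zero (pow_ne_zero _ two_ne_zero) hc0
  have hDt : D ≠ ⊤ := ENNReal.mul_ne_top (by finiteness) hct
  -- `W` comes from integrating out the masses and `D` from the total mass and the factor 2^{2n-1}.
  -- Both are finite and positive for every β > 0, whether or not the model is finite.
  refine ⟨D⁻¹ * W, mul_ne_zero (ENNReal.inv_ne_zero.2 hDt) hw0,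
    ENNReal.mul_ne_top (ENNReal.inv_ne_top.2 hD0) hwt, ?_⟩
  ext s hs
  have hmul := lintegral_modelWeight_mul (β := β) (a := a) (V := V)
    (g := s.indicator 1) (measurable_one.indicator hs)
  have hmap : (modelMeasure n β a V).map (fun p => orderedEigenvalues p.1 p.2) s =
      ∫⁻ p in modelDomain n, ENNReal.ofReal (modelWeight n β a V p) *
        s.indicator 1 (orderedEigenvalues p.1 p.2) := by
    have hind : Measurable (s.indicator (1 : (Fin n → ℝ) → ℝ≥0∞)) := measurable_one.indicator hs
    have hae := hind.comp_aemeasurable (aemeasurable_orderedEigenvalues (n := n))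
    rw [← lintegral_indicator_one hs, lintegral_map' hind.aemeasurable
      aemeasurable_orderedEigenvalues_modelMeasure, modelMeasure]
    exact lintegral_withDensity_eq_lintegral_mul₀
      (measurable_modelWeight n β a V).ennreal_ofReal.aemeasurable hae
  rw [← restrict_ensembleMeasure_apply hs, ← hmap] at hmul
  have hmul' : W * (ensembleMeasure n β a V).restrict {l | StrictMono l} s =
      D * (modelMeasure n β a V).map (fun p => orderedEigenvalues p.1 p.2) s :=
    hmul.trans (by simp only [D]; ring)
  rw [Measure.smul_apply, smul_eq_mul, mul_assoc, hmul', ← mul_assoc,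
    ENNReal.inv_mul_cancel hD0 hDt, one_mul]

theorem ensembleMeasure_strictMono_ne_zero :
    (ensembleMeasure n β a V).restrict {l | StrictMono l} Set.univ ≠ 0 := by
  rw [restrict_ensembleMeasure_apply .univ]
  simpa using lintegral_ensembleWeight_strictMono_ne_zero

theorem ensembleMeasure_univ_ne_top (hn : 1 ≤ n) (hβ : 0 < β) (ha : -1 < a)
    (hV : Filter.Tendsto (fun t : ℝ => V.eval t) Filter.atTop Filter.atTop) :
    ensembleMeasure n β a V Set.univ ≠ ⊤ := by
  rw [ensembleMeasure, withDensity_apply _ .univ, Measure.restrict_univ]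
  exact lintegral_ensembleWeight_ne_top hn hβ ha hV

theorem sum_map_comp_perm_ensembleMeasure (hβ : 0 < β) :
    ∑ σ : Equiv.Perm (Fin n), ((ensembleMeasure n β a V).restrict {l | StrictMono l}).map
      (fun l => l ∘ σ) = ensembleMeasure n β a V :=
  sum_map_comp_perm_restrict map_comp_perm_ensembleMeasure (ensembleMeasure_not_injective hβ)

theorem ensembleMeasure_univ_eq (hβ : 0 < β) :
    ensembleMeasure n β a V Set.univ =
      n ! * (ensembleMeasure n β a V).restrict {l | StrictMono l} Set.univ := by
  conv_lhs => rw [← sum_map_comp_perm_ensembleMeasure hβ]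
  rw [Measure.finsetSum_apply]
  simp only [Measure.map_apply (measurable_comp_perm _) .univ, Set.preimage_univ]
  rw [Finset.sum_const, Finset.card_univ, Fintype.card_perm, Fintype.card_fin, nsmul_eq_mul]

theorem factorial_smul_restrict_betaEnsemble (hβ : 0 < β) :
    (n ! : ℝ≥0∞) • (betaEnsemble n β a V).restrict {l | StrictMono l} =
      normalizedMeasure ((ensembleMeasure n β a V).restrict {l | StrictMono l}) := by
  have hf : (n ! : ℝ≥0∞) ≠ 0 := by exact_mod_cast n.factorial_ne_zero
  have hft : (n ! : ℝ≥0∞) ≠ ⊤ := ENNReal.natCast_ne_top _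
  rw [betaEnsemble_eq, normalizedMeasure, normalizedMeasure, Measure.restrict_smul,
    ensembleMeasure_univ_eq hβ, smul_smul, ENNReal.mul_inv (Or.inl hf) (Or.inl hft), ← mul_assoc,
    ENNReal.mul_inv_cancel hf hft, one_mul]

theorem map_modelLaw_eq [NeZero n] (hβ : 0 < β) :
    (modelLaw n β a V).map (fun p => orderedEigenvalues p.1 p.2) =
      (n ! : ℝ≥0∞) • (betaEnsemble n β a V).restrict {l | StrictMono l} := by
  obtain ⟨C, hC0, hCt, hC⟩ := exists_map_modelMeasure_eq (n := n) (a := a) (V := V) hβ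
  rw [factorial_smul_restrict_betaEnsemble hβ, modelLaw_eq,
    map_normalizedMeasure aemeasurable_orderedEigenvalues_modelMeasure, hC,
    normalizedMeasure_smul hC0 hCt]

theorem isProbabilityMeasure_betaEnsemble (hn : 1 ≤ n) (hβ : 0 < β) (ha : -1 < a)
    (hV : Filter.Tendsto (fun t : ℝ => V.eval t) Filter.atTop Filter.atTop) :
    IsProbabilityMeasure (betaEnsemble n β a V) := by
  refine isProbabilityMeasure_normalizedMeasure ?_ (ensembleMeasure_univ_ne_top hn hβ ha hV)
  change ensembleMeasure n β a V Set.univ ≠ 0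
  rw [ensembleMeasure_univ_eq hβ]
  exact mul_ne_zero (by exact_mod_cast n.factorial_ne_zero) ensembleMeasure_strictMono_ne_zero

/-- A pushforward keeps the total mass, so finiteness and positivity come from the ensemble. -/
theorem isProbabilityMeasure_modelLaw (hn : 1 ≤ n) (hβ : 0 < β) (ha : -1 < a)
    (hV : Filter.Tendsto (fun t : ℝ => V.eval t) Filter.atTop Filter.atTop) :
    IsProbabilityMeasure (modelLaw n β a V) := by
  have : NeZero n := ⟨by omega⟩
  obtain ⟨C, hC0, hCt, hC⟩ := exists_map_modelMeasure_eq (n := n) (a := a) (V := V) hβ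
  have huniv := congrArg (fun μ => μ Set.univ) hC
  simp only [Measure.map_apply_of_aemeasurable aemeasurable_orderedEigenvalues_modelMeasure
    MeasurableSet.univ, Set.preimage_univ, Measure.smul_apply, smul_eq_mul] at huniv
  refine isProbabilityMeasure_normalizedMeasure ?_ ?_
  · change modelMeasure n β a V Set.univ ≠ 0
    rw [huniv]
    exact mul_ne_zero hC0 ensembleMeasure_strictMono_ne_zero
  · change modelMeasure n β a V Set.univ ≠ ⊤
    rw [huniv]
    refine ENNReal.mul_ne_top hCt (ne_top_of_le_ne_top (ensembleMeasure_univ_ne_top hn hβ ha hV)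
      (Measure.restrict_apply_le _ _))

end Pushforward

/-! ### The linear potential and chi variables. -/

section Gaussian

/-- The unnormalized law of a rescaled `χ_r` variable. -/
noncomputable def scaledChiMeasure (κ r : ℝ) : Measure ℝ :=
  (volume.restrict (Set.Ioi 0)).withDensity
    fun t => ENNReal.ofReal (t ^ (r - 1) * Real.exp (-(κ / 2) * t ^ (2 : ℝ)))

theorem measurable_scaledChi (κ r : ℝ) :
    Measurable fun t : ℝ => t ^ (r - 1) * Real.exp (-(κ / 2) * t ^ (2 : ℝ)) :=
  (measurable_id.pow_const _).mul (Real.measurable_exp.comp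
    (measurable_const.mul (measurable_id.pow_const _)))

instance (κ r : ℝ) : SigmaFinite (scaledChiMeasure κ r) :=
  SigmaFinite.withDensity_ofReal _

theorem scaledChiMeasure_univ_ne_zero (κ r : ℝ) : scaledChiMeasure κ r Set.univ ≠ 0 := by
  rw [scaledChiMeasure, withDensity_apply _ .univ, Measure.restrict_univ]
  exact lintegral_rpow_mul_exp_ne_zero r (κ / 2) 2

theorem scaledChiMeasure_univ_ne_top {κ r : ℝ} (hκ : 0 < κ) (hr : 0 < r) :
    scaledChiMeasure κ r Set.univ ≠ ⊤ := by
  rw [scaledChiMeasure, withDensity_apply _ .univ, Measure.restrict_univ]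
  exact lintegral_rpow_mul_exp_ne_top hr (half_pos hκ) two_pos

theorem chiLaw_eq (r : ℝ) : chiLaw r = normalizedMeasure (scaledChiMeasure 1 r) := by
  rw [chiLaw, scaledChiMeasure]
  congr 3
  ext t
  rw [Real.rpow_two]
  congr 3
  ring

/-- Substitution t = √κ u: the power contributes `r - 1` factors √κ and the volume element one more.
-/
theorem map_div_scaledChiMeasure {κ : ℝ} (hκ : 0 < κ) (r : ℝ) :
    (scaledChiMeasure 1 r).map (fun t => t / √κ) =
      ENNReal.ofReal (√κ ^ r) • scaledChiMeasure κ r := by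
  have hs : 0 < √κ := Real.sqrt_pos.2 hκ
  have hdiv : Measurable fun t : ℝ => t / √κ := measurable_id.div_const _
  have hf := (measurable_scaledChi 1 r).ennreal_ofReal
  ext A hA
  rw [Measure.map_apply hdiv hA, Measure.smul_apply, smul_eq_mul, scaledChiMeasure,
    scaledChiMeasure, withDensity_apply _ (hdiv hA), withDensity_apply _ hA,
    Measure.restrict_restrict (hdiv hA), Measure.restrict_restrict hA,
    ← lintegral_indicator ((hdiv hA).inter measurableSet_Ioi),
    ← lintegral_indicator (hA.inter measurableSet_Ioi),
    ← lintegral_const_mul' _ _ ENNReal.ofReal_ne_top]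
  conv_lhs => rw [← Real.smul_map_volume_mul_left hs.ne']
  rw [lintegral_smul_measure, lintegral_map (hf.indicator ((hdiv hA).inter measurableSet_Ioi))
    (measurable_const_mul _), smul_eq_mul, ← lintegral_const_mul' _ _ ENNReal.ofReal_ne_top]
  refine lintegral_congr fun u => ?_
  by_cases hu : u ∈ A ∩ Set.Ioi 0
  · have hu0 : 0 < u := hu.2
    have hu' : √κ * u ∈ (fun t : ℝ => t / √κ) ⁻¹' A ∩ Set.Ioi 0 :=
      ⟨by simpa [mul_div_cancel_left₀ _ hs.ne'] using hu.1, mul_pos hs hu0⟩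
    rw [Set.indicator_of_mem hu, Set.indicator_of_mem hu', ← ENNReal.ofReal_mul (abs_nonneg _),
      ← ENNReal.ofReal_mul (by positivity), abs_of_pos hs, Real.mul_rpow hs.le hu0.le,
      Real.mul_rpow hs.le hu0.le, Real.rpow_two √κ, Real.sq_sqrt hκ.le,
      Real.rpow_sub_one hs.ne' r]
    congr 1
    have : -(1 / 2) * (κ * u ^ (2 : ℝ)) = -(κ / 2) * u ^ (2 : ℝ) := by ring
    rw [this]
    field_simp
  · have hu' : √κ * u ∉ (fun t : ℝ => t / √κ) ⁻¹' A ∩ Set.Ioi 0 := fun h => hu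
      ⟨by simpa [mul_div_cancel_left₀ _ hs.ne'] using h.1, (mul_pos_iff_of_pos_left hs).1 h.2⟩
    rw [Set.indicator_of_notMem hu, Set.indicator_of_notMem hu', mul_zero, mul_zero]

theorem map_div_chiLaw {κ : ℝ} (hκ : 0 < κ) (r : ℝ) :
    (chiLaw r).map (fun t => t / √κ) = normalizedMeasure (scaledChiMeasure κ r) := by
  have hs : 0 < √κ := Real.sqrt_pos.2 hκ
  have hdiv : Measurable fun t : ℝ => t / √κ := measurable_id.div_const _
  rw [chiLaw_eq, map_normalizedMeasure hdiv.aemeasurable,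
    map_div_scaledChiMeasure hκ, normalizedMeasure_smul _ ENNReal.ofReal_ne_top]
  rw [Ne, ENNReal.ofReal_eq_zero, not_le]
  positivity

variable {n : ℕ}

theorem pi_scaledChiMeasure (κ : ℝ) (r : Fin n → ℝ) :
    Measure.pi (fun k => scaledChiMeasure κ (r k)) =
      (volume.restrict {x : Fin n → ℝ | ∀ k, 0 < x k}).withDensity fun x =>
        ∏ k, ENNReal.ofReal (x k ^ (r k - 1) * Real.exp (-(κ / 2) * x k ^ (2 : ℝ))) := by
  have : ∀ k, SigmaFinite ((volume.restrict (Set.Ioi 0)).withDensity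
    fun t => ENNReal.ofReal (t ^ (r k - 1) * Real.exp (-(κ / 2) * t ^ (2 : ℝ)))) := fun k =>
      SigmaFinite.withDensity_ofReal _
  rw [restrict_forall_pos, ← pi_withDensity _ fun k => (measurable_scaledChi κ (r k)).ennreal_ofReal]
  rfl

/-- The trace of BBᵀ is the sum of the squared entries of B; this decouples the coordinates for a
linear potential. -/
theorem trace_tridiagonal (x : Fin n → ℝ) (y : Fin (n - 1) → ℝ) :
    (tridiagonal x y).trace = ∑ i, x i ^ 2 + ∑ i, y i ^ 2 := by
  have h1 : (tridiagonal x y).trace = ∑ j, ∑ i, bidiagonal x y i j ^ 2 := by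
    rw [Finset.sum_comm]
    refine Finset.sum_congr rfl fun i _ => ?_
    rw [Matrix.diag_apply, tridiagonal, Matrix.mul_apply]
    exact Finset.sum_congr rfl fun j _ => by rw [Matrix.transpose_apply, sq]
  have h2 : ∀ j : Fin n, ∑ i, bidiagonal x y i j ^ 2 =
      x j ^ 2 + if h : (j : ℕ) < n - 1 then y ⟨j, h⟩ ^ 2 else 0 := by
    intro j
    rw [← Finset.add_sum_erase _ _ (Finset.mem_univ j)]
    congr 1
    · simp [bidiagonal]
    · split_ifs with h
      · rw [Finset.sum_eq_single ⟨j + 1, by omega⟩]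
        · rw [bidiagonal, if_neg (by simp [Fin.ext_iff]), dif_pos rfl, neg_sq]
        · intro i hi hij
          rw [bidiagonal, if_neg (Finset.ne_of_mem_erase hi), dif_neg fun h => hij (Fin.ext h)]
          simp
        · intro h
          exact absurd (Finset.mem_erase.2 ⟨by simp [Fin.ext_iff], Finset.mem_univ _⟩) h
      · refine Finset.sum_eq_zero fun i hi => ?_
        rw [bidiagonal, if_neg (Finset.ne_of_mem_erase hi), dif_neg (by omega)]
        simp
  rw [h1]
  simp only [h2]
  rw [Finset.sum_add_distrib]
  congr 1
  obtain _ | m := n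
  · simp
  · rw [Fin.sum_univ_castSucc]
    simp

theorem modelWeight_half_mul_X {β a : ℝ} (x : Fin n → ℝ) (y : Fin (n - 1) → ℝ) :
    modelWeight n β a (C (1 / 2) * Polynomial.X) (x, y) =
      (∏ k : Fin n, (x k ^ (β * (((k : ℕ) + 1 : ℝ) + a) - 1) *
        Real.exp (-(n * β / 2) * x k ^ (2 : ℝ)))) *
      ∏ k : Fin (n - 1), (y k ^ (β * ((k : ℕ) + 1 : ℝ) - 1) *
        Real.exp (-(n * β / 2) * y k ^ (2 : ℝ))) := by
  have h : (aeval (tridiagonal x y) (C (1 / 2 : ℝ) * Polynomial.X)).trace =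
      1 / 2 * (∑ i, x i ^ 2 + ∑ i, y i ^ 2) := by
    rw [← trace_tridiagonal, map_mul, aeval_C, aeval_X, Algebra.algebraMap_eq_smul_one,
      smul_mul_assoc, one_mul, Matrix.trace_smul, smul_eq_mul]
  rw [modelWeight, h, Finset.prod_mul_distrib, Finset.prod_mul_distrib, ← Real.exp_sum,
    ← Real.exp_sum]
  have h2 : -(n * β * (1 / 2 * (∑ i, x i ^ 2 + ∑ i, y i ^ 2))) =
      (∑ k, -(n * β / 2) * x k ^ (2 : ℝ)) + ∑ k, -(n * β / 2) * y k ^ (2 : ℝ) := by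
    simp only [Real.rpow_two, ← Finset.mul_sum]
    ring
  rw [h2, Real.exp_add]
  ring

/-- For a linear potential, the entries of the bidiagonal matrix are independent. -/
theorem modelLaw_half_mul_X {β a : ℝ} (hn : 1 ≤ n) (hβ : 0 < β) (ha : -1 < a) :
    modelLaw n β a (C (1 / 2) * Polynomial.X) =
      (Measure.pi fun k : Fin n =>
        (chiLaw (β * (((k : ℕ) + 1 : ℝ) + a))).map (fun t => t / √(n * β))).prod
      (Measure.pi fun k : Fin (n - 1) =>
        (chiLaw (β * ((k : ℕ) + 1 : ℝ))).map (fun t => t / √(n * β))) := by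
  have hκ : 0 < n * β := mul_pos (by exact_mod_cast hn) hβ
  have hrx : ∀ k : Fin n, 0 < β * (((k : ℕ) + 1 : ℝ) + a) := fun k =>
    mul_pos hβ (by have : (0 : ℝ) ≤ (k : ℕ) := Nat.cast_nonneg _; linarith)
  have hry : ∀ k : Fin (n - 1), 0 < β * ((k : ℕ) + 1 : ℝ) := fun k => by positivity
  simp only [map_div_chiLaw hκ]
  rw [normalizedMeasure_pi (fun _ => scaledChiMeasure_univ_ne_zero _ _)
      fun k => scaledChiMeasure_univ_ne_top hκ (hrx k),
    normalizedMeasure_pi (fun _ => scaledChiMeasure_univ_ne_zero _ _)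
      fun k => scaledChiMeasure_univ_ne_top hκ (hry k), normalizedMeasure_prod]
  · rw [modelLaw_eq]
    congr 1
    rw [pi_scaledChiMeasure, pi_scaledChiMeasure, prod_withDensity, Measure.prod_restrict,
      modelMeasure]
    · refine withDensity_congr_ae ((ae_restrict_iff' measurableSet_modelDomain).2
        (.of_forall fun p hp => ?_))
      simp only
      rw [modelWeight_half_mul_X, ENNReal.ofReal_mul, ENNReal.ofReal_prod_of_nonneg,
        ENNReal.ofReal_prod_of_nonneg]
      · exact fun k _ => mul_nonneg (Real.rpow_nonneg (hp.2 k).le _) (Real.exp_nonneg _)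
      · exact fun k _ => mul_nonneg (Real.rpow_nonneg (hp.1 k).le _) (Real.exp_nonneg _)
      · exact Finset.prod_nonneg fun k _ =>
          mul_nonneg (Real.rpow_nonneg (hp.1 k).le _) (Real.exp_nonneg _)
    · exact Finset.measurable_prod _ fun k _ =>
        (measurable_scaledChi _ _).ennreal_ofReal.comp (measurable_pi_apply k)
    · exact Finset.measurable_prod _ fun k _ =>
        (measurable_scaledChi _ _).ennreal_ofReal.comp (measurable_pi_apply k)
  · rw [Measure.pi_univ]
    exact Finset.prod_ne_zero_iff.2 fun k _ => scaledChiMeasure_univ_ne_zero _ _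
  · rw [Measure.pi_univ]
    exact ENNReal.prod_ne_top fun k _ => scaledChiMeasure_univ_ne_top hκ (hrx k)

end Gaussian

theorem mainTheorem4 (n : ℕ) (hn : 1 ≤ n) (β a : ℝ) (hβ : 0 < β) (ha : -1 < a)
    (V : ℝ[X]) (hV : Filter.Tendsto (fun t : ℝ => V.eval t) Filter.atTop Filter.atTop) :
    -- the two densities can be normalized
    IsProbabilityMeasure (modelLaw n β a V) ∧
    IsProbabilityMeasure (betaEnsemble n β a V) ∧
    -- the eigenvalues of `B(X,Y) B(X,Y)ᵀ` form the `β`-ensemble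
    (∀ (Ω : Type*) [MeasurableSpace Ω] (P : Measure Ω)
      (X : Ω → Fin n → ℝ) (Y : Ω → Fin (n - 1) → ℝ),
      HasLaw (fun ω => (X ω, Y ω)) (modelLaw n β a V) P →
      -- listed in increasing order, they have `n!` times the ensemble density on the
      -- set of strictly increasing vectors
      HasLaw (fun ω => orderedEigenvalues (X ω) (Y ω))
        ((n ! : ℝ≥0∞) • (betaEnsemble n β a V).restrict {l | StrictMono l}) P ∧
      -- listed in a uniformly random order, they have the ensemble density
      (n ! : ℝ≥0∞)⁻¹ • ∑ σ : Equiv.Perm (Fin n),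
          P.map (fun ω => orderedEigenvalues (X ω) (Y ω) ∘ σ) = betaEnsemble n β a V) ∧
    -- for `V(t) = t / 2`, all coordinates are independent chi variables divided by `√(n β)`
    (V = C (1 / 2) * Polynomial.X →
      modelLaw n β a V =
        (Measure.pi fun k : Fin n =>
          (chiLaw (β * (((k : ℕ) + 1 : ℝ) + a))).map (fun t => t / √(n * β))).prod
        (Measure.pi fun k : Fin (n - 1) =>
          (chiLaw (β * ((k : ℕ) + 1 : ℝ))).map (fun t => t / √(n * β)))) := by
  have : NeZero n := ⟨by omega⟩
  refine ⟨isProbabilityMeasure_modelLaw hn hβ ha hV, isProbabilityMeasure_betaEnsemble hn hβ ha hV,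
    fun Ω _ P X Y hXY => ?_, ?_⟩
  · have hae : AEMeasurable (fun p : (Fin n → ℝ) × (Fin (n - 1) → ℝ) =>
        orderedEigenvalues p.1 p.2) (P.map fun ω => (X ω, Y ω)) := by
      rw [hXY.map_eq, modelLaw_eq]
      exact aemeasurable_orderedEigenvalues_modelMeasure.smul_measure _
    have hlaw : HasLaw (fun ω => orderedEigenvalues (X ω) (Y ω))
        ((n ! : ℝ≥0∞) • (betaEnsemble n β a V).restrict {l | StrictMono l}) P := by
      refine ⟨hae.comp_aemeasurable hXY.aemeasurable, ?_⟩
      rw [← map_modelLaw_eq hβ, ← hXY.map_eq, AEMeasurable.map_map_of_aemeasurable hae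
        hXY.aemeasurable]
      rfl
    refine ⟨hlaw, ?_⟩
    have hf : (n ! : ℝ≥0∞) ≠ 0 := by exact_mod_cast n.factorial_ne_zero
    -- Each ordering contributes the image of one sorted chamber, and summed over `σ` these images
    -- reassemble the exchangeable ensemble.
    have hσ : ∀ σ : Equiv.Perm (Fin n),
        P.map (fun ω => orderedEigenvalues (X ω) (Y ω) ∘ σ) =
          ((n ! : ℝ≥0∞) * (ensembleMeasure n β a V Set.univ)⁻¹) •
            ((ensembleMeasure n β a V).restrict {l | StrictMono l}).map (fun l => l ∘ σ) := by
      intro σ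
      have h1 := AEMeasurable.map_map_of_aemeasurable
        (measurable_comp_perm σ).aemeasurable hlaw.aemeasurable
      rw [hlaw.map_eq, betaEnsemble_eq, normalizedMeasure, Measure.restrict_smul, smul_smul,
        Measure.map_smul] at h1
      exact h1.symm
    simp only [hσ]
    rw [← Finset.smul_sum, sum_map_comp_perm_ensembleMeasure hβ, smul_smul, ← mul_assoc,
      ENNReal.inv_mul_cancel hf (ENNReal.natCast_ne_top _), one_mul]
    rfl
  · rintro rfl
    exact modelLaw_half_mul_X hn hβ ha
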